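/- **Lemma 1 (MGF of the SNR under MFTR fading).** Let $m>0$ be real, and for real $\mu>0$, $K>0$, $\Delta\in[0,1]$, $\bar\gamma>0$ and complex $s$ put $$\mathcal R(s)=\big[(m+\mu K)^2-(\mu K\Delta)^2\big]\bar\gamma^2s^2-2m\mu(1+K)(m+\mu K)\bar\gamma s+\big[(1+K)m\mu\big]^2 .$$ Let $P_\alpha(z)={}_2F_1\big(-\alpha,\alpha+1;1;\tfrac{1-z}{2}\big)$ be the Legendre function of the first kind, where ${}_2F_1$ denotes the principal branch (the analytic continuation of the Gauss series along straight segments from $0$). Powers and square roots below are principal. *Physical model (natural $\mu\ge 1$).* Let $V_1,V_2,U_2,\dots,U_\mu\ge 0$ be not all zero, let $\sigma,E_s,N_0>0$, and let $\zeta,\phi_1,\phi_2,\varphi_2,\dots,\varphi_\mu,X_1,Y_1,\dots,X_\mu,Y_\mu$ be mutually independent real random variables, with $\zeta$ Gamma distributed with shape $m$ and rate $m$ (unit mean), all phases uniform on $(0,2\pi)$, and $X_i,Y_i\sim\mathcal N(0,\sigma^2)$. Put $Z_i=X_i+jY_i$ and $$\gamma=\frac{E_s}{N_0}\Big(\big|\sqrt\zeta\,(V_1e^{j\phi_1}+V_2e^{j\phi_2})+Z_1\big|^2+\sum_{i=2}^{\mu}\big|\sqrt\zeta\,U_ie^{j\varphi_i}+Z_i\big|^2\Big),\qquad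 \bar\gamma=\mathbb E\{\gamma\},$$ $$K=\frac{V_1^2+V_2^2+\sum_{i=2}^\mu U_i^2}{2\sigma^2\mu},\qquad \Delta=\frac{2V_1V_2}{V_1^2+V_2^2+\sum_{i=2}^\mu U_i^2}.$$ *Model with real $\mu>0$.* Let $\mu,K,\bar\gamma>0$ and $\Delta\in[0,1]$, and let $\gamma$ be a random variable with the following distribution: let $\theta$ be uniform on $(0,2\pi)$ and let $\zeta$, independent of $\theta$, be Gamma distributed with shape $m$ and rate $m$; conditionally on $(\zeta,\theta)$, $\gamma$ has the noncentral Gamma ($\kappa$-$\mu$) density $$x\mapsto\sum_{k=0}^\infty e^{-\lambda}\frac{\lambda^k}{k!}\,\frac{r^{\mu+k}x^{\mu+k-1}e^{-rx}}{\Gamma(\mu+k)}\quad(x>0),\qquad r=\frac{\mu(1+K)}{\bar\gamma},\quad \lambda=\zeta\,\mu K(1+\Delta\cos\theta).$$ In either model, for every complex $s$ with $$\big(m+\mu K(1+\Delta)\big)\,\bar\gamma\,\operatorname{Re}s<m\mu(1+K)$$ (in particular for every $s$ with $\operatorname{Re} s\le 0$), the variable $e^{s\gamma}$ is integrable and $$\mathcal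 M_\gamma(s)=\mathbb E\{e^{s\gamma}\}=\frac{m^m\mu^\mu(1+K)^\mu\big(\mu(1+K)-\bar\gamma s\big)^{m-\mu}}{\big(\sqrt{\mathcal R(s)}\big)^m}\;P_{m-1}\!\left(\frac{m\mu(1+K)-(\mu K+m)\bar\gamma s}{\sqrt{\mathcal R(s)}}\right).$$ -/

import Mathlib

open MeasureTheory ProbabilityTheory
open scoped ENNReal Topology

noncomputable section

/-- The labels of the elementary random sources of a multi-cluster fluctuating two-ray signal with
`n` additional clusters (so `n + 1` clusters altogether): the common fluctuation `ζ`, the phases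
`φ₁, φ₂` of the two specular components of the first cluster, the phase of the specular component
of each additional cluster, and the in-phase and quadrature diffuse components `X i`, `Y i` of every
cluster (`0` is the first cluster, `i.succ` is the additional cluster `i`). -/
inductive MFTRSource (n : ℕ) : Type
  | fluctuation : MFTRSource n
  | phase₁ : MFTRSource n
  | phase₂ : MFTRSource n
  | clusterPhase (i : Fin n) : MFTRSource n
  | inPhase (i : Fin (n + 1)) : MFTRSource n
  | quadrature (i : Fin (n + 1)) : MFTRSource n

/-- The uniform distribution on `(0, 2π)`. -/
def uniformPhase : Measure ℝ := ProbabilityTheory.cond volume (Set.Ioo 0 (2 * Real.pi))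

/-- The distribution of each source: `ζ` is Gamma with shape `m` and rate `m` (unit mean), the
phases are uniform on `(0, 2π)`, the diffuse components are centred Gaussian of variance `σ²`. -/
def MFTRSource.law {n : ℕ} (m σ : ℝ) : MFTRSource n → Measure ℝ
  | .fluctuation => gammaMeasure m m
  | .phase₁ => uniformPhase
  | .phase₂ => uniformPhase
  | .clusterPhase _ => uniformPhase
  | .inPhase _ => gaussianReal 0 (Real.toNNReal (σ ^ 2))
  | .quadrature _ => gaussianReal 0 (Real.toNNReal (σ ^ 2))

/-- `ξ` is a family of mutually independent sources with the prescribed distributions. -/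
structure IsMFTRSources {Ω : Type*} [MeasurableSpace Ω] (P : Measure Ω) {n : ℕ} (m σ : ℝ)
    (ξ : MFTRSource n → Ω → ℝ) : Prop where
  indep : iIndepFun ξ P
  hasLaw : ∀ j, HasLaw (ξ j) (j.law m σ) P

/-- The received power `W = R²`:
`|√ζ (V₁ e^{jφ₁} + V₂ e^{jφ₂}) + Z₁|² + ∑ i, |√ζ Uᵢ e^{jφᵢ} + Zᵢ|²`, with `Zᵢ = Xᵢ + j Yᵢ`. -/
def mftrPower {Ω : Type*} {n : ℕ} (V₁ V₂ : ℝ) (U : Fin n → ℝ) (ξ : MFTRSource n → Ω → ℝ)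
    (ω : Ω) : ℝ :=
  ‖((√(ξ .fluctuation ω) : ℝ) : ℂ) *
        (V₁ * Complex.exp (ξ .phase₁ ω * Complex.I) + V₂ * Complex.exp (ξ .phase₂ ω * Complex.I))
      + (ξ (.inPhase 0) ω + ξ (.quadrature 0) ω * Complex.I)‖ ^ 2
    + ∑ i : Fin n,
      ‖((√(ξ .fluctuation ω) : ℝ) : ℂ) *
          (U i * Complex.exp (ξ (.clusterPhase i) ω * Complex.I))
        + (ξ (.inPhase i.succ) ω + ξ (.quadrature i.succ) ω * Complex.I)‖ ^ 2

/-- The total power `V₁² + V₂² + ∑ Uᵢ²` of the specular components. -/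
def specularPower {n : ℕ} (V₁ V₂ : ℝ) (U : Fin n → ℝ) : ℝ :=
  V₁ ^ 2 + V₂ ^ 2 + ∑ i, U i ^ 2

/-- The parameter `K` of a signal with `n + 1` clusters. -/
def mftrK {n : ℕ} (V₁ V₂ : ℝ) (U : Fin n → ℝ) (σ : ℝ) : ℝ :=
  specularPower V₁ V₂ U / (2 * σ ^ 2 * ((n : ℝ) + 1))

/-- The parameter `Δ`. -/
def mftrΔ {n : ℕ} (V₁ V₂ : ℝ) (U : Fin n → ℝ) : ℝ :=
  2 * V₁ * V₂ / specularPower V₁ V₂ U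

/-- The noncentral Gamma density of real shape `μ`, rate `r` and noncentrality `l`, as the
Poisson(`l`) mixture of the Gamma densities of shapes `μ + k` and rate `r`. For a natural number `μ`
this is the density of a sum of `μ` squared moduli `|Zᵢ + pᵢ|²`, where the `Zᵢ` are independent
circular complex Gaussians of total power `1 / r` and `l = r ∑ |pᵢ|²` (a scaled noncentral
chi-squared variable with `2μ` degrees of freedom); for real `μ` it is the `κ`-`μ` density. -/
def noncentralGammaPDF (μ r l x : ℝ) : ℝ≥0∞ :=
  ∑' k : ℕ, ENNReal.ofReal (Real.exp (-l) * l ^ k / (k.factorial : ℝ)) * gammaPDF (μ + k) r x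

/-- The density of the signal-to-noise ratio of mean `g` for a real number `μ > 0` of clusters.
Given the fluctuation `ζ = z` and the phase difference `θ` of the two specular components of the
first cluster, the signal-to-noise ratio is noncentral Gamma of shape `μ`, with rate
`μ (1 + K) / g` and with noncentrality `z μ K (1 + Δ cos θ)` (the ratio of specular to diffuse power
times `μ`); then `z` and `θ` are averaged over their distributions. -/
def mftrPDF (μ m K Δ g x : ℝ) : ℝ≥0∞ :=
  ∫⁻ θ, ∫⁻ z, noncentralGammaPDF μ (μ * (1 + K) / g) (z * (μ * K * (1 + Δ * Real.cos θ))) x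
    ∂(gammaMeasure m m) ∂uniformPhase

/-- The distribution of the signal-to-noise ratio for a real number `μ > 0` of clusters. -/
def mftrMeasure (μ m K Δ g : ℝ) : Measure ℝ :=
  volume.withDensity (mftrPDF μ m K Δ g)

open Classical in
/-- The principal branch of the Gauss hypergeometric function: the value at `x` of the analytic
continuation of the Gauss series from `0` along the segment `[0, x]`. It exists for every `x`
outside the cut `[1, ∞)` and is unique by the identity theorem; on the unit disc it is the sum of
the series. -/
def gaussHypergeometric (a b c x : ℂ) : ℂ :=
  if h : ∃ F : ℂ → ℂ, AnalyticOnNhd ℂ F (segment ℝ 0 x) ∧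
      F =ᶠ[𝓝 0] (ordinaryHypergeometric a b c : ℂ → ℂ)
  then h.choose x else 0

/-- The Legendre function of the first kind of real degree `α`. -/
def legendreFun (α : ℝ) (z : ℂ) : ℂ :=
  gaussHypergeometric (-(α : ℂ)) ((α : ℂ) + 1) 1 ((1 - z) / 2)

/-- The quadratic polynomial `R(μ, m, K, Δ; s)`, for the mean `g`. -/
def mftrR (μ m K Δ g : ℝ) (s : ℂ) : ℂ :=
  (((m + μ * K) ^ 2 - (μ * K * Δ) ^ 2 : ℝ) : ℂ) * (g : ℂ) ^ 2 * s ^ 2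
    - 2 * m * μ * (1 + K) * (m + μ * K) * g * s
    + ((1 + K) * m * μ) ^ 2

/-- The closed form of the moment generating function, for the mean `g`; powers and the square
root are principal. -/
def mftrClosedForm (μ m K Δ g : ℝ) (s : ℂ) : ℂ :=
  (m : ℂ) ^ (m : ℂ) * (μ : ℂ) ^ (μ : ℂ) * (1 + K : ℂ) ^ (μ : ℂ)
      * (μ * (1 + K) - g * s) ^ ((m : ℂ) - μ)
    / Complex.sqrt (mftrR μ m K Δ g s) ^ (m : ℂ)
    * legendreFun (m - 1)
      ((m * μ * (1 + K) - (μ * K + m) * g * s) / Complex.sqrt (mftrR μ m K Δ g s))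

/-- The moment generating function `s ↦ E[exp (s γ)]` of `γ` exists and is given by the closed form
on the half-plane to the left of the first zero of `R`. -/
def HasMFTRMGF {Ω : Type*} [MeasurableSpace Ω] (P : Measure Ω) (γ : Ω → ℝ)
    (μ m K Δ g : ℝ) : Prop :=
  ∀ s : ℂ, (m + μ * K * (1 + Δ)) * g * s.re < m * μ * (1 + K) →
    Integrable (fun ω => Complex.exp (s * γ ω)) P ∧
      complexMGF γ P s = mftrClosedForm μ m K Δ g s

end

/-! Conditionally on the phase difference `θ` and the fluctuation `ζ`, the signal-to-noise ratio is
noncentral Gamma, with moment generating function `(r/(r-s))^μ * exp (λ w)`, where `r = μ(1+K)/g`,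
`λ = ζ μK(1 + Δ cos θ)` and `w = s/(r-s) = g s/D`, `D = μ(1+K) - g s`. Averaging over the Gamma
variable `ζ` turns the exponential into `(1 - μK(1 + Δ cos θ) w/m)^(-m)`, and only an integral over
`θ` remains.

The base of that power is `((1 + cos θ)/2 * p + (1 - cos θ)/2 * q) / (m D)`, where `p` and `q` are
affine in `s`, `p q = R(s)` and `(p + q)/2` is the numerator of the Legendre argument. Laplace's
integral (`integral_legendre`) evaluates the average as `√(p q)^(-m) * P_{m-1}((p + q)/(2 √(p q)))`.
The condition on `s` is exactly `0 < re p`; it forces `0 < re q` and `0 < re D`, so the principal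
powers split without crossing a cut (`mftrClosedForm_eq`).

Laplace's integral reduces to `p = u`, `q = u⁻¹`. With `t = (u-1)/(u+1)` the base factors as `(1 + t
e^{iθ})(1 + t e^{-iθ})/(1 - t²)`. Parseval for two binomial series gives `₂F₁(m, m; 1; t²)`, and
Pfaff's transformation, which also realizes the principal branch on `re x < 1/2`, identifies this
with the Legendre function.

Both models are brought to the integral in `mftrClosedForm_eq_integral`. For real `μ`, the law is a
Poisson mixture of Gamma laws averaged over `(θ, ζ)`. In the physical model, the power is the
squared norm of a Gaussian vector in `2(n+1)` real dimensions with an independent random shift. Its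
moment generating function depends on the shift only through the squared length `ζ (S + 2 V₁ V₂ cos
(φ₁ - φ₂))`, with `S` the specular power, and `cos (φ₁ - φ₂)` has the law of `cos θ`. The mean is
computed separately in `IsMFTRSources.integral_snr`. -/

/-! ### Binomial series and Pfaff's transformation -/

/-- The coefficient `(m)ₙ / n!` of `xⁿ` in `(1 - x) ^ (-m)`. -/
noncomputable def negBinomialCoeff (m : ℝ) (n : ℕ) : ℝ :=
  (ascPochhammer ℝ n).eval m / (n.factorial : ℝ)

lemma negBinomialCoeff_pos {m : ℝ} (hm : 0 < m) (n : ℕ) : 0 < negBinomialCoeff m n :=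
  div_pos (ascPochhammer_pos n m hm) (by positivity)

lemma negBinomialCoeff_eq_multichoose (m : ℝ) (n : ℕ) :
    negBinomialCoeff m n = Ring.multichoose m n := by
  have h := Ring.factorial_nsmul_multichoose_eq_ascPochhammer m n
  rw [Polynomial.ascPochhammer_smeval_cast, Polynomial.ascPochhammer_smeval_eq_eval,
    nsmul_eq_mul] at h
  rw [negBinomialCoeff, ← h, mul_div_cancel_left₀ _ (by positivity)]

lemma ringChoose_neg_eq (m : ℝ) (n : ℕ) :
    Ring.choose (-m) n = (-1) ^ n * negBinomialCoeff m n := by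
  rw [Ring.choose_neg', negBinomialCoeff_eq_multichoose, Ring.multichoose_eq]
  simp [Units.smul_def]

lemma hasSum_negBinomial (m : ℝ) {x : ℂ} (hx : ‖x‖ < 1) :
    HasSum (fun n => (negBinomialCoeff m n : ℂ) * x ^ n) ((1 - x) ^ (-m : ℂ)) := by
  have h := (Complex.one_add_cpow_hasFPowerSeriesOnBall_zero (a := (-m : ℂ))).hasSum (y := -x)
    (by simpa [← ENNReal.ofReal_one, Metric.eball_ofReal] using hx)
  rw [zero_add, ← sub_eq_add_neg] at h
  refine Eq.subst (motive := fun f => HasSum f _) (funext fun n => ?_) h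
  symm
  rw [binomialSeries_apply]
  rw [show (-(m : ℂ)) = ((-m : ℝ) : ℂ) by simp, ← Complex.ofReal_choose, ringChoose_neg_eq]
  simp only [List.ofFn_const, List.prod_replicate, smul_eq_mul]
  rw [neg_pow x]
  push_cast
  have : ((-1 : ℂ)) ^ n * (-1) ^ n = 1 := by rw [← mul_pow]; simp
  linear_combination (-(negBinomialCoeff m n : ℂ) * x ^ n) * this

lemma hasSum_negBinomial_real (m : ℝ) {x : ℝ} (h0 : 0 ≤ x) (hx : x < 1) :
    HasSum (fun n => negBinomialCoeff m n * x ^ n) ((1 - x) ^ (-m)) := by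
  have h := hasSum_negBinomial m (x := (x : ℂ)) (by simpa [abs_of_nonneg h0] using hx)
  rw [← Complex.hasSum_ofReal]
  rw [Complex.ofReal_cpow (by linarith)]
  simpa using h

/-- These terms are the diagonal of the double series obtained by squaring the binomial series at
`√x`. -/
lemma summable_negBinomial_sq {m : ℝ} (hm : 0 < m) {x : ℝ} (h0 : 0 ≤ x) (hx : x < 1) :
    Summable (fun n => negBinomialCoeff m n ^ 2 * x ^ n) := by
  have h := (hasSum_negBinomial_real m (Real.sqrt_nonneg x)
    (by rw [Real.sqrt_lt' one_pos]; simpa using hx)).summable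
  have hnn : ∀ n, 0 ≤ negBinomialCoeff m n * √x ^ n := fun n =>
    mul_nonneg (negBinomialCoeff_pos hm n).le (by positivity)
  have := (h.mul_of_nonneg h hnn hnn).comp_injective (i := fun n : ℕ => (n, n))
    (fun a b h => (Prod.ext_iff.mp h).1)
  refine this.congr fun n => ?_
  simp only [Function.comp]
  rw [← Real.sq_sqrt h0, ← pow_mul, Real.sqrt_sq (Real.sqrt_nonneg x)]
  ring

/-- A product of two ascending factorials. -/
lemma negBinomialCoeff_mul_shift (m : ℝ) (k j : ℕ) :
    negBinomialCoeff m k * negBinomialCoeff (m + k) j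
      = negBinomialCoeff m (k + j) * ((k + j).choose k : ℝ) := by
  have h := ascPochhammer_mul ℝ k j
  have h' := congrArg (Polynomial.eval m) h
  rw [Polynomial.eval_mul, Polynomial.eval_comp] at h'
  simp only [Polynomial.eval_add, Polynomial.eval_X, Polynomial.eval_natCast] at h'
  have hc : ((k + j).choose k : ℝ) = (k + j).factorial / (k.factorial * j.factorial) := by
    rw [Nat.cast_choose ℝ (Nat.le_add_right k j)]; simp
  unfold negBinomialCoeff
  rw [hc, ← h']
  have := (k + j).factorial_ne_zero
  field_simp

/-- Chu–Vandermonde with upper arguments `-m` and `n`. It is what produces the parameter `1 - m` in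
Pfaff's transformation. -/
lemma sum_choose_mul_negBinomialCoeff (m : ℝ) (n : ℕ) :
    ∑ p ∈ Finset.HasAntidiagonal.antidiagonal n, (-1) ^ p.1 * negBinomialCoeff m p.1 * (n.choose
        p.1 : ℝ)
      = negBinomialCoeff (1 - m) n := by
  have h := Ring.add_choose_eq n (Commute.all (-m) (n : ℝ))
  have h2 : Ring.choose (-m + n) n = negBinomialCoeff (1 - m) n := by
    rw [negBinomialCoeff_eq_multichoose, Ring.multichoose_eq]
    congr 1; ring
  rw [← h2, h]
  refine Finset.sum_congr rfl fun p hp => ?_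
  rw [ringChoose_neg_eq, Ring.choose_natCast]
  rw [Finset.HasAntidiagonal.mem_antidiagonal] at hp
  rw [← Nat.choose_symm_of_eq_add (n := n) (a := p.1) (b := p.2) (by omega)]

lemma ordinaryHypergeometric_eq_tsum_negBinomial (a b : ℝ) (x : ℂ) :
    ordinaryHypergeometric (a : ℂ) (b : ℂ) (1 : ℂ) x
      = ∑' n, (negBinomialCoeff a n * negBinomialCoeff b n : ℝ) * x ^ n := by
  rw [ordinaryHypergeometric_eq_tsum]
  refine tsum_congr fun n => ?_
  have key : ∀ c : ℝ, (ascPochhammer ℂ n).eval (c : ℂ) = ((ascPochhammer ℝ n).eval c : ℝ) := by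
    intro c
    rw [← ascPochhammer_map (algebraMap ℝ ℂ) n, Polynomial.eval_map_algebraMap]
    exact Polynomial.aeval_algebraMap_apply_eq_algebraMap_eval c _
  rw [key, key, ascPochhammer_eval_one]
  unfold negBinomialCoeff
  simp only [smul_eq_mul]
  push_cast
  ring

/-- The double series behind the Pfaff transformation. -/
lemma summable_pfaff {m : ℝ} (hm : 0 < m) {x : ℂ} (hx : ‖x‖ < 1 / 2) :
    Summable (fun p : ℕ × ℕ => ((negBinomialCoeff m p.1) ^ 2 * (-1) ^ p.1 : ℂ) * x ^ p.1
      * ((negBinomialCoeff (m + p.1) p.2 : ℂ) * x ^ p.2)) := by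
  have hx1 : ‖x‖ < 1 := by linarith
  refine Summable.of_norm ?_
  have hn : ∀ p : ℕ × ℕ, ‖((negBinomialCoeff m p.1) ^ 2 * (-1) ^ p.1 : ℂ) * x ^ p.1
      * ((negBinomialCoeff (m + p.1) p.2 : ℂ) * x ^ p.2)‖ = negBinomialCoeff m p.1 ^ 2 * ‖x‖ ^ p.1
        * (negBinomialCoeff (m + p.1) p.2 * ‖x‖ ^ p.2) := by
    intro p
    simp [abs_of_pos (negBinomialCoeff_pos (m := m + p.1) (by positivity) p.2)]
  simp only [hn]
  have hpos : ∀ (k j : ℕ), 0 < negBinomialCoeff (m + k) j :=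
    fun k j => negBinomialCoeff_pos (by positivity) j
  refine (summable_prod_of_nonneg fun p => ?_).2 ⟨fun k => ?_, ?_⟩
  · have := hpos p.1 p.2
    simp only [Pi.zero_apply]; positivity
  · exact ((hasSum_negBinomial_real (m + k) (norm_nonneg x) hx1).summable.mul_left
      (negBinomialCoeff m k ^ 2 * ‖x‖ ^ k))
  -- Each row sums to a multiple of `(1 - ‖x‖)^(-m-k)`, leaving a series in `‖x‖/(1 - ‖x‖)`; this
  -- ratio is below 1 precisely because `‖x‖ < 1/2`.
  · have : ∀ k : ℕ, ∑' j, negBinomialCoeff m k ^ 2 * ‖x‖ ^ k *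
        (negBinomialCoeff (m + k) j * ‖x‖ ^ j)
        = negBinomialCoeff m k ^ 2 * (‖x‖ / (1 - ‖x‖)) ^ k * (1 - ‖x‖) ^ (-m) := by
      intro k
      rw [tsum_mul_left, (hasSum_negBinomial_real (m + k) (norm_nonneg x) hx1).tsum_eq, div_pow,
        neg_add, Real.rpow_add (by linarith), Real.rpow_neg (by linarith) (k : ℝ),
            Real.rpow_natCast]
      ring
    simp only [this]
    refine (summable_negBinomial_sq hm ?_ ?_).mul_right _
    · exact div_nonneg (norm_nonneg x) (by linarith)
    · rw [div_lt_one (by linarith)]; linarith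

/-- The Pfaff transformation of `₂F₁(1 - m, m; 1; x)`, near the origin. -/
lemma ordinaryHypergeometric_pfaff {m : ℝ} (hm : 0 < m) {x : ℂ} (hx : ‖x‖ < 1 / 2) :
    (1 - x) ^ (-m : ℂ) * ordinaryHypergeometric (m : ℂ) (m : ℂ) (1 : ℂ) (x / (x - 1))
      = ordinaryHypergeometric ((1 - m : ℝ) : ℂ) (m : ℂ) (1 : ℂ) x := by
  have hx1 : ‖x‖ < 1 := by linarith
  have hne : 1 - x ≠ 0 := by
    intro h
    rw [← sub_eq_zero.mp h] at hx1; simp at hx1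
  have hne' : x - 1 ≠ 0 := by rw [← neg_sub]; exact neg_ne_zero.mpr hne
  have hS := summable_pfaff hm hx
  rw [ordinaryHypergeometric_eq_tsum_negBinomial, ordinaryHypergeometric_eq_tsum_negBinomial,
    ← tsum_mul_left]
  have h1 := hS.tsum_prod
  have h2 := (Finset.HasAntidiagonal.sigmaAntidiagonalEquivProd (A := ℕ)).tsum_eq
    (fun p : ℕ × ℕ => ((negBinomialCoeff m p.1) ^ 2 * (-1) ^ p.1 : ℂ) * x ^ p.1
      * ((negBinomialCoeff (m + p.1) p.2 : ℂ) * x ^ p.2))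
  have hS' := ((Finset.HasAntidiagonal.sigmaAntidiagonalEquivProd (A := ℕ)).summable_iff
    (f := (fun p : ℕ × ℕ => ((negBinomialCoeff m p.1) ^ 2 * (-1) ^ p.1 : ℂ) * x ^ p.1
      * ((negBinomialCoeff (m + p.1) p.2 : ℂ) * x ^ p.2)))).mpr hS
  have h3 := hS'.tsum_sigma' (fun n => (hasSum_fintype _).summable)
  simp only [Function.comp_def, Finset.HasAntidiagonal.sigmaAntidiagonalEquivProd_apply] at h2 h3
  rw [h2, h1] at h3
  -- The double series is summed in two ways: rows by the binomial series of exponent `-(m + k)`,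
  -- antidiagonals by Chu–Vandermonde.
  refine Eq.trans (tsum_congr fun k => ?_) (h3.trans (tsum_congr fun n => ?_))
  · have h := hasSum_negBinomial (m + k) hx1
    simp only
    rw [tsum_mul_left, h.tsum_eq]
    have e1 : (1 - x) ^ (-((m + k : ℝ) : ℂ)) = (1 - x) ^ (-m : ℂ) * ((1 - x) ^ k)⁻¹ := by
      push_cast
      rw [neg_add, Complex.cpow_add _ _ hne, Complex.cpow_neg _ (k : ℂ), Complex.cpow_natCast]
    rw [e1, show x / (x - 1) = (-1) * x * (1 - x)⁻¹ by field_simp; ring, mul_pow, mul_pow, inv_pow]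
    push_cast
    ring
  · rw [tsum_fintype, Finset.sum_coe_sort (Finset.HasAntidiagonal.antidiagonal n)
      (fun p : ℕ × ℕ => ((negBinomialCoeff m p.1) ^ 2 * (-1) ^ p.1 : ℂ) * x ^ p.1
      * ((negBinomialCoeff (m + p.1) p.2 : ℂ) * x ^ p.2)),
      ← sum_choose_mul_negBinomialCoeff]
    push_cast
    rw [Finset.sum_mul, Finset.sum_mul]
    refine Finset.sum_congr rfl fun p hp => ?_
    rw [Finset.HasAntidiagonal.mem_antidiagonal] at hp
    subst hp
    have h := congrArg (fun y : ℝ => (y : ℂ)) (negBinomialCoeff_mul_shift m p.1 p.2)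
    push_cast at h
    rw [pow_add]
    linear_combination ((negBinomialCoeff m p.1) * (-1) ^ p.1 : ℂ) * x ^ p.1 * x ^ p.2 * h

/-! ### The principal branch -/

/-- For `m > 0` none of the parameters `m, m, 1` is a nonpositive integer, so the series never
terminates and its radius is exactly 1. The untransformed series lacks this uniformity: `1 - m` may
be a nonpositive integer. -/
lemma analyticOnNhd_ordinaryHypergeometric {m : ℝ} (hm : 0 < m) :
    AnalyticOnNhd ℂ (ordinaryHypergeometric (m : ℂ) (m : ℂ) (1 : ℂ) : ℂ → ℂ)
      (Metric.ball 0 1) := by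
  have hr := ordinaryHypergeometricSeries_radius_eq_one ℂ (m : ℂ) (m : ℂ) (1 : ℂ) (fun k => by
    have h1 : (k : ℂ) ≠ -(m : ℂ) := by
      intro h
      have := congrArg Complex.re h
      simp at this
      have := Nat.cast_nonneg (α := ℝ) k
      linarith
    refine ⟨h1, h1, fun h => ?_⟩
    have := congrArg Complex.re h
    simp at this
    have := Nat.cast_nonneg (α := ℝ) k
    linarith)
  have h := (ordinaryHypergeometricSeries ℂ (m : ℂ) (m : ℂ) (1 : ℂ)).hasFPowerSeriesOnBall
    (by rw [hr]; exact one_pos)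
  rw [hr] at h
  have h' := h.analyticOnNhd
  rwa [← ENNReal.ofReal_one, Metric.eball_ofReal] at h'

/-- The principal branch of `₂F₁(1 - m, m; 1; x)` on the half-plane `re x < 1 / 2`. -/
lemma gaussHypergeometric_eq {m : ℝ} (hm : 0 < m) {x : ℂ} (hx : x.re < 1 / 2) :
    gaussHypergeometric ((1 - m : ℝ) : ℂ) (m : ℂ) 1 x
      = (1 - x) ^ (-m : ℂ) * ordinaryHypergeometric (m : ℂ) (m : ℂ) (1 : ℂ) (x / (x - 1)) := by
  set F : ℂ → ℂ := fun x =>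
    (1 - x) ^ (-m : ℂ) * ordinaryHypergeometric (m : ℂ) (m : ℂ) (1 : ℂ) (x / (x - 1)) with hF
  have hana : AnalyticOnNhd ℂ F {y | y.re < 1 / 2} := by
    intro y hy
    have hy' : y.re < 1 / 2 := hy
    have hy1 : y - 1 ≠ 0 := by
      intro h
      have := congrArg Complex.re h
      simp at this
      linarith
    refine AnalyticAt.mul ?_ ?_
    · refine (analyticAt_const.sub analyticAt_id).cpow analyticAt_const ?_
      left
      simp
      linarith
    · refine AnalyticAt.fun_comp ?_ (analyticAt_id.div (analyticAt_id.sub analyticAt_const) hy1)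
      refine analyticOnNhd_ordinaryHypergeometric hm _ ?_
      -- The half-plane `re y < 1/2` consists of the points closer to 0 than to 1, so `y/(y-1)` lies
      -- in the unit disc.
      rw [mem_ball_zero_iff, norm_div, div_lt_one (norm_pos_iff.mpr hy1)]
      rw [← sq_lt_sq₀ (norm_nonneg _) (norm_nonneg _), Complex.sq_norm, Complex.sq_norm,
        Complex.normSq_apply, Complex.normSq_apply]
      simp
      nlinarith
  have hev : F =ᶠ[𝓝 0] (ordinaryHypergeometric ((1 - m : ℝ) : ℂ) (m : ℂ) 1 : ℂ → ℂ) := by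
    filter_upwards [Metric.ball_mem_nhds (0 : ℂ) (by norm_num : (0 : ℝ) < 1 / 2)] with y hy
    exact ordinaryHypergeometric_pfaff hm (by simpa using hy)
  have hseg : segment ℝ 0 x ⊆ {y : ℂ | y.re < 1 / 2} :=
    (convex_halfSpace_re_lt (1 / 2)).segment_subset (by simp) hx
  have hex : ∃ F : ℂ → ℂ, AnalyticOnNhd ℂ F (segment ℝ 0 x) ∧
      F =ᶠ[𝓝 0] (ordinaryHypergeometric ((1 - m : ℝ) : ℂ) (m : ℂ) 1 : ℂ → ℂ) :=
    ⟨F, hana.mono hseg, hev⟩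
  rw [gaussHypergeometric, dif_pos hex]
  -- The chosen continuation is arbitrary, but it shares its germ at 0 with `F`; the identity
  -- theorem on the connected segment forces equality at `x`.
  exact hex.choose_spec.1.eqOn_of_preconnected_of_eventuallyEq (hana.mono hseg)
    (convex_segment 0 x).isPreconnected (left_mem_segment ℝ 0 x)
    (hex.choose_spec.2.trans hev.symm) (right_mem_segment ℝ 0 x)

/-! ### Fourier series on the unit circle -/

lemma integral_exp_int_mul_I (k : ℤ) :
    ∫ θ in (0 : ℝ)..2 * Real.pi, Complex.exp (k * θ * Complex.I) = if k = 0 then 2 * Real.pi else 0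
        := by
  split_ifs with h
  · simp [h]
  · have hk : (k * Complex.I : ℂ) ≠ 0 := by simp [h]
    have := integral_exp_mul_complex (a := 0) (b := 2 * Real.pi) hk
    rw [show (fun θ : ℝ => Complex.exp (k * θ * Complex.I)) = fun θ : ℝ => Complex.exp (k *
        Complex.I * θ) by
      ext; ring_nf, this]
    rw [show k * Complex.I * ((2 * Real.pi : ℝ) : ℂ) = k * (2 * Real.pi * Complex.I) by
        push_cast; ring,
      Complex.exp_int_mul_two_pi_mul_I]
    simp

/-- Termwise integration of a binomial series along the unit circle. -/
lemma hasSum_integral_negBinomial (m : ℝ) (e : ℝ → ℂ) (he : Continuous e) (hn : ∀ θ, ‖e θ‖ = 1)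
    (h : ℝ → ℂ) (hh : Continuous h) {t : ℂ} (ht : ‖t‖ < 1) :
    HasSum (fun n => (negBinomialCoeff m n : ℂ) * (-t) ^ n
      * ∫ θ in (0 : ℝ)..2 * Real.pi, e θ ^ n * h θ)
      (∫ θ in (0 : ℝ)..2 * Real.pi, (1 + t * e θ) ^ (-m : ℂ) * h θ) := by
  obtain ⟨C, hC⟩ := (isCompact_Icc (a := (0 : ℝ)) (b := 2 * Real.pi)).exists_bound_of_continuousOn
    hh.continuousOn
  have hs : Summable fun n => ‖(negBinomialCoeff m n : ℂ) * (-t) ^ n‖ :=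
    (hasSum_negBinomial m (x := -t) (by simpa using ht)).summable.norm
  have := intervalIntegral.hasSum_integral_of_dominated_convergence (μ := volume) (a := 0)
    (b := 2 * Real.pi)
    (F := fun n θ => (negBinomialCoeff m n : ℂ) * (-t) ^ n * (e θ ^ n * h θ))
    (f := fun θ => (1 + t * e θ) ^ (-m : ℂ) * h θ)
    (fun n _ => ‖(negBinomialCoeff m n : ℂ) * (-t) ^ n‖ * C)
    (fun n => by
      refine Continuous.aestronglyMeasurable ?_
      fun_prop)
    (fun n => by
      refine Filter.Eventually.of_forall fun θ hθ => ?_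
      rw [norm_mul, norm_mul (e θ ^ n), norm_pow (e θ), hn, one_pow, one_mul]
      rw [Set.uIoc_of_le (by positivity)] at hθ
      exact mul_le_mul_of_nonneg_left (hC θ (Set.Ioc_subset_Icc_self hθ)) (norm_nonneg _))
    (Filter.Eventually.of_forall fun θ _ => hs.mul_right C)
    (by simp)
    (Filter.Eventually.of_forall fun θ _ => by
      have h1 := (hasSum_negBinomial m (x := -t * e θ) (by simpa [hn] using ht)).mul_right (h θ)
      rw [show 1 - -t * e θ = 1 + t * e θ by ring] at h1
      refine Eq.subst (motive := fun f => HasSum f _) (funext fun n => ?_) h1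
      rw [mul_pow]; ring)
  simpa only [intervalIntegral.integral_const_mul] using this

/-- Parseval's identity for the two binomial series. -/
lemma integral_circle_negBinomial {m : ℝ} {t : ℂ} (ht : ‖t‖ < 1) :
    ∫ θ in (0 : ℝ)..2 * Real.pi, (1 + t * Complex.exp (θ * Complex.I)) ^ (-m : ℂ)
        * (1 + t * Complex.exp (-θ * Complex.I)) ^ (-m : ℂ)
      = 2 * Real.pi * ordinaryHypergeometric (m : ℂ) (m : ℂ) (1 : ℂ) (t ^ 2) := by
  have hn1 : ∀ θ : ℝ, ‖Complex.exp (θ * Complex.I)‖ = 1 := Complex.norm_exp_ofReal_mul_I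
  have hn2 : ∀ θ : ℝ, ‖Complex.exp (-θ * Complex.I)‖ = 1 := fun θ => by
    simpa using Complex.norm_exp_ofReal_mul_I (-θ)
  have hcont : Continuous fun θ : ℝ => (1 + t * Complex.exp (-θ * Complex.I)) ^ (-m : ℂ) := by
    refine Continuous.cpow (by fun_prop) continuous_const fun θ => ?_
    refine Complex.mem_slitPlane_of_norm_lt_one ?_
    rw [norm_mul, hn2, mul_one]
    exact ht
  -- Only the factor in `e^{iθ}` is expanded here; the other one is carried along as a continuous
  -- weight.
  have h1 := hasSum_integral_negBinomial m (fun θ : ℝ => Complex.exp (θ * Complex.I)) (by fun_prop)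
      hn1
    _ hcont ht
  rw [← h1.tsum_eq, ordinaryHypergeometric_eq_tsum_negBinomial, ← tsum_mul_left]
  refine tsum_congr fun n => ?_
  -- Expanding the second factor against `e^{inθ}`, orthogonality leaves the single term `k = n`.
  have h2 := hasSum_integral_negBinomial m (fun θ : ℝ => Complex.exp (-θ * Complex.I)) (by
      fun_prop) hn2
    (fun θ : ℝ => Complex.exp (θ * Complex.I) ^ n) (by fun_prop) ht
  have h3 : ∀ k : ℕ, ∫ θ in (0 : ℝ)..2 * Real.pi, Complex.exp (-θ * Complex.I) ^ k
      * Complex.exp (θ * Complex.I) ^ n = if k = n then 2 * Real.pi else 0 := by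
    intro k
    have := integral_exp_int_mul_I ((n : ℤ) - k)
    simp only [sub_eq_zero, Nat.cast_inj, eq_comm (a := n)] at this
    rw [← this]
    congr 1
    ext θ
    rw [← Complex.exp_nat_mul, ← Complex.exp_nat_mul, ← Complex.exp_add]
    congr 1
    push_cast
    ring
  simp only [h3] at h2
  have h4 := h2.unique (hasSum_single n fun k hk => by simp [hk])
  rw [show (∫ θ in (0 : ℝ)..2 * Real.pi, Complex.exp (θ * Complex.I) ^ n
    * (1 + t * Complex.exp (-θ * Complex.I)) ^ (-m : ℂ)) = _ from
      (intervalIntegral.integral_congr fun θ _ => mul_comm _ _).trans h4]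
  simp only [if_true]
  rw [← pow_mul, neg_pow t, mul_comm 2 n, pow_mul]
  have : ((-1 : ℂ)) ^ n * (-1) ^ n = 1 := by rw [← mul_pow]; simp
  push_cast
  linear_combination (2 * Real.pi * (negBinomialCoeff m n : ℂ) ^ 2 * (t ^ n) ^ 2) * this

/-! ### Principal powers on the right half-plane -/

namespace Complex

/-- Both arguments lie in `(-π/2, π/2)`, so their sum stays in `(-π, π)` and the principal logarithm
is additive. -/
lemma mul_cpow_of_re_pos {a b : ℂ} (ha : 0 < a.re) (hb : 0 < b.re) (s : ℂ) :
    (a * b) ^ s = a ^ s * b ^ s := by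
  have ha0 : a ≠ 0 := by rintro rfl; simp at ha
  have hb0 : b ≠ 0 := by rintro rfl; simp at hb
  have h1 := abs_lt.mp (abs_arg_lt_pi_div_two_iff.mpr (Or.inl ha))
  have h2 := abs_lt.mp (abs_arg_lt_pi_div_two_iff.mpr (Or.inl hb))
  rw [cpow_def_of_ne_zero (mul_ne_zero ha0 hb0), cpow_def_of_ne_zero ha0, cpow_def_of_ne_zero hb0,
    log_mul ha0 hb0 ⟨by linarith, by linarith⟩, add_mul, exp_add]

lemma re_inv_pos {a : ℂ} (ha : 0 < a.re) : 0 < a⁻¹.re := by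
  have ha0 : a ≠ 0 := by rintro rfl; simp at ha
  rw [inv_re]
  exact div_pos ha (normSq_pos.mpr ha0)

lemma inv_cpow_of_re_pos {a : ℂ} (ha : 0 < a.re) (s : ℂ) : a⁻¹ ^ s = (a ^ s)⁻¹ := by
  refine inv_cpow _ _ fun h => ?_
  have := abs_arg_lt_pi_div_two_iff.mpr (Or.inl ha)
  rw [h, abs_of_pos Real.pi_pos] at this
  linarith [Real.pi_pos]

lemma div_cpow_of_re_pos {a b : ℂ} (ha : 0 < a.re) (hb : 0 < b.re) (s : ℂ) :
    (a / b) ^ s = a ^ s / b ^ s := by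
  rw [div_eq_mul_inv, mul_cpow_of_re_pos ha (re_inv_pos hb), inv_cpow_of_re_pos hb, div_eq_mul_inv]

lemma sqrt_mul_self_eq (a : ℂ) : sqrt a * sqrt a = a := by
  rcases eq_or_ne a 0 with rfl | ha
  · simp
  · rw [sqrt, ← cpow_add _ _ ha]
    norm_num

/-- The principal root sends the right half-plane into the sector `|arg| < π/4`, since `re (z²) =
(re z)² - (im z)²`. -/
lemma abs_im_sqrt_lt_re_sqrt {a : ℂ} (ha : 0 < a.re) : |(sqrt a).im| < (sqrt a).re := by
  have h1 := congrArg re (sqrt_mul_self_eq a)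
  rw [mul_re] at h1
  have h2 : 0 ≤ (sqrt a).re := by
    rw [sqrt, cpow_inv_two_re]
    positivity
  refine abs_lt_of_sq_lt_sq ?_ h2
  nlinarith

lemma sqrt_mul_of_re_pos {a b : ℂ} (ha : 0 < a.re) (hb : 0 < b.re) :
    sqrt (a * b) = sqrt a * sqrt b := mul_cpow_of_re_pos ha hb _

lemma re_mul_pos_of_abs_im_lt {a b : ℂ} (ha : |a.im| < a.re) (hb : |b.im| < b.re) :
    0 < (a * b).re := by
  rw [mul_re]
  have h : a.im * b.im ≤ |a.im| * |b.im| := by rw [← abs_mul]; exact le_abs_self _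
  have := mul_lt_mul'' ha hb (abs_nonneg _) (abs_nonneg _)
  linarith

/-- The weights are nonnegative with sum 1, and the right half-plane is convex. -/
lemma re_cos_average_pos {p q : ℂ} (hp : 0 < p.re) (hq : 0 < q.re) (θ : ℝ) :
    0 < (((1 + Real.cos θ) / 2 : ℝ) * p + ((1 - Real.cos θ) / 2 : ℝ) * q).re := by
  have hc1 := Real.neg_one_le_cos θ
  have hc2 := Real.cos_le_one θ
  rw [add_re, re_ofReal_mul, re_ofReal_mul]
  rcases eq_or_lt_of_le hc1 with h | h
  · rw [← h]
    norm_num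
    exact hq
  · have : 0 < (1 + Real.cos θ) / 2 * p.re := mul_pos (by linarith) hp
    have : 0 ≤ (1 - Real.cos θ) / 2 * q.re := mul_nonneg (by linarith) hq.le
    linarith

end Complex

/-! ### Laplace's integral for the Legendre function -/

/-- Laplace's integral for the Legendre function, with the argument `(u + u⁻¹) / 2`. -/
lemma integral_legendre_joukowsky {m : ℝ} (hm : 0 < m) {u : ℂ} (hu : 0 < u.re) :
    ∫ θ in (0 : ℝ)..2 * Real.pi,
        (((1 + Real.cos θ) / 2 : ℝ) * u + ((1 - Real.cos θ) / 2 : ℝ) * u⁻¹) ^ (-m : ℂ)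
      = 2 * Real.pi * legendreFun (m - 1) ((u + u⁻¹) / 2) := by
  have hu0 : u ≠ 0 := by rintro rfl; simp at hu
  have hu1 : u + 1 ≠ 0 := by
    intro h
    have := congrArg Complex.re h
    simp at this
    linarith
  -- The Cayley transform maps the right half-plane onto the unit disc; this `t` makes the integrand
  -- factor over the circle.
  set t : ℂ := (u - 1) / (u + 1) with ht_def
  have ht : ‖t‖ < 1 := by
    rw [ht_def, norm_div, div_lt_one (norm_pos_iff.mpr hu1), ← sq_lt_sq₀ (norm_nonneg _)
        (norm_nonneg _),
      Complex.sq_norm, Complex.sq_norm, Complex.normSq_apply, Complex.normSq_apply]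
    simp
    nlinarith
  have hpos : ∀ z : ℂ, ‖z‖ < 1 → 0 < (1 + z).re := by
    intro z hz
    have := (abs_lt.mp ((Complex.abs_re_le_norm z).trans_lt hz)).1
    simp
    linarith
  have ht2 : 0 < (1 - t ^ 2).re := by
    rw [sub_eq_add_neg]
    refine hpos _ ?_
    rw [norm_neg, norm_pow]
    exact pow_lt_one₀ (norm_nonneg _) ht two_ne_zero
  have hbase : ∀ θ : ℝ, (((1 + Real.cos θ) / 2 : ℝ) * u + ((1 - Real.cos θ) / 2 : ℝ) * u⁻¹) ^ (-m :
      ℂ)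
      = (1 - t ^ 2) ^ (m : ℂ) * ((1 + t * Complex.exp (θ * Complex.I)) ^ (-m : ℂ)
        * (1 + t * Complex.exp (-θ * Complex.I)) ^ (-m : ℂ)) := by
    intro θ
    set b : ℂ := ((1 + Real.cos θ) / 2 : ℝ) * u + ((1 - Real.cos θ) / 2 : ℝ) * u⁻¹ with hb
    have hui := Complex.re_inv_pos hu
    have hbre : 0 < b.re := Complex.re_cos_average_pos hu hui θ
    have h1 : 0 < (1 + t * Complex.exp (θ * Complex.I)).re := by
      refine hpos _ ?_
      rw [norm_mul, Complex.norm_exp_ofReal_mul_I, mul_one]; exact ht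
    have h2 : 0 < (1 + t * Complex.exp (-θ * Complex.I)).re := by
      refine hpos _ ?_
      have := Complex.norm_exp_ofReal_mul_I (-θ)
      push_cast at this
      rw [norm_mul, this, mul_one]; exact ht
    have hprod : b * (1 - t ^ 2) = (1 + t * Complex.exp (θ * Complex.I))
        * (1 + t * Complex.exp (-θ * Complex.I)) := by
      have he : Complex.exp (θ * Complex.I) * Complex.exp (-θ * Complex.I) = 1 := by
        rw [← Complex.exp_add]; simp
      have hcos : Complex.exp (θ * Complex.I) + Complex.exp (-θ * Complex.I) = 2 * (Real.cos θ : ℂ)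
          := by
        rw [Complex.ofReal_cos, Complex.two_cos]
      have : (1 + t * Complex.exp (θ * Complex.I)) * (1 + t * Complex.exp (-θ * Complex.I))
          = 1 + t * (2 * (Real.cos θ : ℂ)) + t ^ 2 := by
        rw [← hcos]; linear_combination t ^ 2 * he
      rw [this, hb, ht_def]
      push_cast
      field_simp
      ring
    have h3 := congrArg (· ^ (-m : ℂ)) hprod
    rw [Complex.mul_cpow_of_re_pos hbre ht2, Complex.mul_cpow_of_re_pos h1 h2] at h3
    rw [← h3, Complex.cpow_neg (1 - t ^ 2), mul_comm, mul_assoc, inv_mul_cancel₀, mul_one]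
    rw [Complex.cpow_def_of_ne_zero (by intro h; rw [h] at ht2; simp at ht2)]
    exact Complex.exp_ne_zero _
  simp only [hbase]
  rw [intervalIntegral.integral_const_mul, integral_circle_negBinomial ht]
  -- Here `x = (1 - z)/2` with `z = (u + u⁻¹)/2` of positive real part; below, `1 - x = (1 - t²)⁻¹`
  -- and `x/(x-1) = t²` match Pfaff's form with the Parseval value.
  have hx : ((1 - (u + u⁻¹) / 2) / 2 : ℂ).re < 1 / 2 := by
    have := Complex.re_inv_pos hu
    have e : ((1 - (u + u⁻¹) / 2) / 2 : ℂ) = ((1 / 2 : ℝ) : ℂ) - ((1 / 4 : ℝ) : ℂ) * (u + u⁻¹) := by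
      push_cast; ring
    rw [e, Complex.sub_re, Complex.re_ofReal_mul, Complex.ofReal_re, Complex.add_re]
    linarith
  have hleg := gaussHypergeometric_eq hm hx
  rw [legendreFun, show (-((m - 1 : ℝ) : ℂ)) = ((1 - m : ℝ) : ℂ) by push_cast; ring,
    show ((m - 1 : ℝ) : ℂ) + 1 = m by push_cast; ring, hleg]
  have e1 : 1 - (1 - (u + u⁻¹) / 2) / 2 = (1 - t ^ 2)⁻¹ := by
    have h : 1 - t ^ 2 = 4 * u / (u + 1) ^ 2 := by
      rw [ht_def]; field_simp; ring
    rw [h]; field_simp; ring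
  have e2 : (1 - (u + u⁻¹) / 2) / 2 / ((1 - (u + u⁻¹) / 2) / 2 - 1) = t ^ 2 := by
    have h1 : (1 - (u + u⁻¹) / 2) / 2 = - (u - 1) ^ 2 / (4 * u) := by field_simp; ring
    have h2 : (1 - (u + u⁻¹) / 2) / 2 - 1 = - (u + 1) ^ 2 / (4 * u) := by field_simp; ring
    rw [h2, h1, ht_def]
    field_simp
  rw [e1, e2, Complex.inv_cpow_of_re_pos ht2, Complex.cpow_neg, inv_inv]
  ring

/-- Laplace's integral in homogeneous form. -/
lemma integral_legendre {m : ℝ} (hm : 0 < m) {p q : ℂ} (hp : 0 < p.re) (hq : 0 < q.re) :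
    ∫ θ in (0 : ℝ)..2 * Real.pi,
        (((1 + Real.cos θ) / 2 : ℝ) * p + ((1 - Real.cos θ) / 2 : ℝ) * q) ^ (-m : ℂ)
      = 2 * Real.pi * ((Complex.sqrt (p * q) ^ (m : ℂ))⁻¹
        * legendreFun (m - 1) ((p + q) / 2 / Complex.sqrt (p * q))) := by
  have ha := Complex.abs_im_sqrt_lt_re_sqrt hp
  have hb := Complex.abs_im_sqrt_lt_re_sqrt hq
  have hpa := Complex.sqrt_mul_self_eq p
  have hqb := Complex.sqrt_mul_self_eq q
  rw [Complex.sqrt_mul_of_re_pos hp hq]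
  set a := Complex.sqrt p
  set b := Complex.sqrt q
  have ha0 : a ≠ 0 := by intro h; rw [h] at ha; simp at ha
  have hb0 : b ≠ 0 := by intro h; rw [h] at hb; simp at hb
  have hab := Complex.re_mul_pos_of_abs_im_lt ha hb
  -- Up to the positive factor `|b|⁻²`, the quotient is `a` times the conjugate of `b`, and both lie
  -- in the sector `|arg| < π/4`.
  have hu : 0 < (a / b).re := by
    have h1 : |((starRingEnd ℂ) b).im| < ((starRingEnd ℂ) b).re := by simpa using hb
    have h2 := Complex.re_mul_pos_of_abs_im_lt ha h1
    rw [div_eq_mul_inv, Complex.inv_def, ← mul_assoc, mul_comm, Complex.re_ofReal_mul]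
    exact mul_pos (inv_pos.mpr (Complex.normSq_pos.mpr hb0)) h2
  have hui := Complex.re_inv_pos hu
  -- Extracting the geometric mean `a b = √p √q` leaves the reciprocal pair `a/b`, `b/a`.
  have key : ∀ θ : ℝ, (((1 + Real.cos θ) / 2 : ℝ) * p + ((1 - Real.cos θ) / 2 : ℝ) * q) ^ (-m : ℂ)
      = (a * b) ^ (-m : ℂ) *
        (((1 + Real.cos θ) / 2 : ℝ) * (a / b) + ((1 - Real.cos θ) / 2 : ℝ) * (a / b)⁻¹) ^ (-m : ℂ)
            := by
    intro θ
    rw [← Complex.mul_cpow_of_re_pos hab, ← hpa, ← hqb]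
    · congr 1
      field_simp
    · exact Complex.re_cos_average_pos hu hui θ
  simp only [key]
  rw [intervalIntegral.integral_const_mul, integral_legendre_joukowsky hm hu, Complex.cpow_neg]
  have : (a / b + (a / b)⁻¹) / 2 = (p + q) / 2 / (a * b) := by
    rw [← hpa, ← hqb]; field_simp
  rw [this]
  ring

/-! ### The closed form as a phase average -/

/-- The closed form as an average over the phase difference. -/
lemma mftrClosedForm_eq {m μ K Δ g : ℝ} (hm : 0 < m) (hμ : 0 < μ) (hK : 0 < K) (h0 : 0 ≤ Δ)
    (h1 : Δ ≤ 1) (hg : 0 < g) {s : ℂ}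
    (hs : (m + μ * K * (1 + Δ)) * g * s.re < m * μ * (1 + K)) :
    mftrClosedForm μ m K Δ g s
      = ((μ * (1 + K)) / (μ * (1 + K) - g * s)) ^ (μ : ℂ) * ((2 * Real.pi)⁻¹ *
        ∫ θ in (0 : ℝ)..2 * Real.pi, (1 - (μ * K * (1 + Δ * Real.cos θ) : ℝ)
          * (g * s / (μ * (1 + K) - g * s)) / m) ^ (-m : ℂ)) := by
  have hμK : 0 < μ * K := mul_pos hμ hK
  -- The values `c = 0`, `μK(1 + Δ)` and `μK(1 - Δ)` give the positive real parts of `m D`, `p` and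
  -- `q` respectively.
  have hgs : ∀ c : ℝ, 0 ≤ c → c ≤ μ * K * (1 + Δ) → 0 < m * (μ * (1 + K)) - (m + c) * (g * s.re) :=
      by
    intro c hc hc'
    rcases le_or_gt s.re 0 with h | h
    · have h1 : (m + c) * (g * s.re) ≤ 0 :=
        mul_nonpos_of_nonneg_of_nonpos (by linarith) (mul_nonpos_of_nonneg_of_nonpos hg.le h)
      have : 0 < m * (μ * (1 + K)) := by positivity
      linarith
    · have : (m + c) * (g * s.re) ≤ (m + μ * K * (1 + Δ)) * (g * s.re) :=
        mul_le_mul_of_nonneg_right (by linarith) (by positivity)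
      nlinarith
  set D : ℂ := μ * (1 + K) - g * s with hD
  have hDre : 0 < D.re := by
    have := hgs 0 le_rfl (by positivity)
    have h : m * D.re = m * (μ * (1 + K)) - (m + 0) * (g * s.re) := by
      simp [hD]; ring
    rw [← h] at this
    exact (pos_iff_pos_of_mul_pos this).mp hm
  have hD0 : D ≠ 0 := by intro h; rw [h] at hDre; simp at hDre
  set p : ℂ := m * (μ * (1 + K)) - (m + μ * K * (1 + Δ)) * (g * s) with hp
  set q : ℂ := m * (μ * (1 + K)) - (m + μ * K * (1 - Δ)) * (g * s) with hq
  have hre : ∀ c : ℝ, ((m * (μ * (1 + K)) - (m + c) * (g * s) : ℂ)).re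
      = m * (μ * (1 + K)) - (m + c) * (g * s.re) := by
    intro c; simp
  have hppos : 0 < p.re := by
    have := hgs _ (by positivity) (le_refl (μ * K * (1 + Δ)))
    rw [← hre] at this
    push_cast at this
    exact this
  have hqpos : 0 < q.re := by
    have := hgs (μ * K * (1 - Δ)) (mul_nonneg hμK.le (by linarith))
      (mul_le_mul_of_nonneg_left (by linarith) hμK.le)
    rw [← hre] at this
    push_cast at this
    exact this
  have hR : mftrR μ m K Δ g s = p * q := by
    rw [mftrR, hp, hq]; push_cast; ring
  have hmD : 0 < (m * D : ℂ).re := by rw [Complex.re_ofReal_mul]; positivity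
  have hm0 : (m : ℂ) ≠ 0 := by exact_mod_cast hm.ne'
  have hint : ∀ θ : ℝ, (1 - (μ * K * (1 + Δ * Real.cos θ) : ℝ) * (g * s / D) / m) ^ (-m : ℂ)
      = (m * D) ^ (m : ℂ) *
        (((1 + Real.cos θ) / 2 : ℝ) * p + ((1 - Real.cos θ) / 2 : ℝ) * q) ^ (-m : ℂ) := by
    intro θ
    have e : (1 - (μ * K * (1 + Δ * Real.cos θ) : ℝ) * (g * s / D) / m : ℂ)
        = (((1 + Real.cos θ) / 2 : ℝ) * p + ((1 - Real.cos θ) / 2 : ℝ) * q) / (m * D) := by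
      rw [hp, hq]
      push_cast
      field_simp
      rw [hD]
      ring
    rw [e, Complex.div_cpow_of_re_pos _ hmD, Complex.cpow_neg (m * D)]
    · field_simp
    · exact Complex.re_cos_average_pos hppos hqpos θ
  simp only [hint]
  rw [intervalIntegral.integral_const_mul, integral_legendre hm hppos hqpos]
  have hpi : (2 * Real.pi : ℂ) ≠ 0 := by
    have := Real.pi_ne_zero
    simp [this]
  have harg : (m * μ * (1 + K) - (μ * K + m) * g * s : ℂ) = (p + q) / 2 := by
    rw [hp, hq]; ring
  have e1 : ((μ * (1 + K)) / D : ℂ) ^ (μ : ℂ) = (μ : ℂ) ^ (μ : ℂ) * (1 + K : ℂ) ^ (μ : ℂ) / D ^ (μ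
      : ℂ) := by
    rw [Complex.div_cpow_of_re_pos _ hDre, Complex.mul_cpow_of_re_pos (by simpa using hμ)]
    · simp; linarith
    · simp; positivity
  have e2 : (m * D : ℂ) ^ (m : ℂ) = (m : ℂ) ^ (m : ℂ) * D ^ (m : ℂ) :=
    Complex.mul_cpow_of_re_pos (by simpa using hm) hDre _
  rw [mftrClosedForm, hR, harg, ← hD, e1, e2, Complex.cpow_sub _ _ hD0]
  push_cast
  field_simp

/-! ### Exponential moments of the Gamma law -/

lemma measurable_gammaPDF (a r : ℝ) : Measurable (gammaPDF a r) :=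
  (measurable_gammaPDFReal a r).ennreal_ofReal

lemma ae_nonneg_gammaMeasure (a r : ℝ) : ∀ᵐ x ∂(gammaMeasure a r), 0 ≤ x := by
  rw [ae_iff, gammaMeasure]
  simp only [not_le]
  rw [show {x : ℝ | x < 0} = Set.Iio 0 from rfl, withDensity_apply _ measurableSet_Iio]
  exact lintegral_gammaPDF_of_nonpos le_rfl

lemma gammaMeasure_integral_eq {a r : ℝ} (f : ℝ → ℂ) :
    ∫ x, f x ∂(gammaMeasure a r) = ∫ x in Set.Ioi (0 : ℝ), (gammaPDF a r x).toReal • f x := by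
  rw [gammaMeasure, integral_withDensity_eq_integral_toReal_smul (measurable_gammaPDF a r)
    (by simp [gammaPDF])]
  rw [← integral_Ici_eq_integral_Ioi, setIntegral_eq_integral_of_forall_compl_eq_zero]
  intro x hx
  rw [gammaPDF_of_neg (by simpa using hx)]
  simp

lemma gammaPDF_toReal_smul {a r : ℝ} (ha : 0 < a) (hr : 0 < r) (w : ℂ) {x : ℝ} (hx : 0 < x) :
    (gammaPDF a r x).toReal • Complex.exp (w * x)
      = ((r ^ a / Real.Gamma a : ℝ) : ℂ) * ((x : ℂ) ^ ((a : ℂ) - 1) * Complex.exp (-((r - w) * x)))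
          := by
  have hG := Real.Gamma_pos_of_pos ha
  rw [gammaPDF_of_nonneg hx.le, ENNReal.toReal_ofReal (by positivity), Complex.real_smul]
  rw [show ((a : ℂ) - 1) = ((a - 1 : ℝ) : ℂ) by push_cast; ring, ← Complex.ofReal_cpow hx.le,
    show -((r - w) * x : ℂ) = ((-(r * x) : ℝ) : ℂ) + w * x by push_cast; ring, Complex.exp_add,
    ← Complex.ofReal_exp]
  push_cast
  ring

lemma integrable_exp_gammaMeasure {a r : ℝ} (ha : 0 < a) (hr : 0 < r) {w : ℂ} (hw : w.re < r) :
    Integrable (fun x : ℝ => Complex.exp (w * x)) (gammaMeasure a r) := by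
  rw [gammaMeasure, integrable_withDensity_iff_integrable_smul' (measurable_gammaPDF a r)
    (by simp [gammaPDF])]
  rw [← integrableOn_univ, ← Set.Iio_union_Ici (a := (0 : ℝ))]
  refine IntegrableOn.union ?_ ?_
  · refine (integrableOn_congr_fun (fun x hx => ?_) measurableSet_Iio).mp integrableOn_zero
    rw [gammaPDF_of_neg hx]; simp
  · rw [integrableOn_Ici_iff_integrableOn_Ioi]
    have h := (integrableOn_rpow_mul_exp_neg_mul_rpow (s := a - 1) (p := 1) (by linarith) one_pos
      (b := r - w.re) (by linarith)).const_mul (r ^ a / Real.Gamma a)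
    refine h.mono' ?_ ?_
    · refine Measurable.aestronglyMeasurable ?_
      have := measurable_gammaPDF a r
      fun_prop
    · refine (ae_restrict_iff' measurableSet_Ioi).mpr (Filter.Eventually.of_forall fun x hx => ?_)
      have hx : 0 < x := hx
      have hG := Real.Gamma_pos_of_pos ha
      rw [gammaPDF_toReal_smul ha hr w hx, norm_mul, norm_mul, Complex.norm_exp,
        show ((a : ℂ) - 1) = ((a - 1 : ℝ) : ℂ) by push_cast; ring, ← Complex.ofReal_cpow hx.le,
        Complex.norm_real, Complex.norm_real, Real.norm_of_nonneg (by positivity),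
        Real.norm_of_nonneg (by positivity), Real.rpow_one]
      refine le_of_eq ?_
      congr 3
      simp
      ring

lemma integral_exp_gammaMeasure_real {a r w : ℝ} (ha : 0 < a) (hr : 0 < r) (hw : w < r) :
    ∫ x, Complex.exp (w * x) ∂(gammaMeasure a r) = ((r : ℂ) / (r - w)) ^ (a : ℂ) := by
  have hw' : 0 < r - w := by linarith
  have hre : 0 < ((r : ℂ) - w).re := by simpa using hw
  have h := Complex.integral_cpow_mul_exp_neg_mul_Ioi (a := a) (by simpa using ha) hw'
  rw [one_div, Complex.ofReal_sub, Complex.inv_cpow_of_re_pos hre] at h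
  rw [gammaMeasure_integral_eq, setIntegral_congr_fun measurableSet_Ioi
    (fun x hx => gammaPDF_toReal_smul ha hr w hx), integral_const_mul, h,
    Complex.div_cpow_of_re_pos (by simpa using hr) hre, Complex.Gamma_ofReal]
  have hG' : (Real.Gamma a : ℂ) ≠ 0 := by exact_mod_cast (Real.Gamma_pos_of_pos ha).ne'
  rw [← Complex.ofReal_cpow hr.le]
  push_cast
  field_simp

/-- The moment generating function of a Gamma distribution. -/
lemma integral_exp_gammaMeasure {a r : ℝ} (ha : 0 < a) (hr : 0 < r) {w : ℂ} (hw : w.re < r) :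
    ∫ x, Complex.exp (w * x) ∂(gammaMeasure a r) = ((r : ℂ) / (r - w)) ^ (a : ℂ) := by
  have hre : ∀ z : ℂ, z.re < r → 0 < ((r : ℂ) - z).re := fun z hz => by simpa using hz
  have hsub : Set.Iio r ⊆ interior (integrableExpSet id (gammaMeasure a r)) := by
    refine interior_maximal (fun t ht => ?_) isOpen_Iio
    have := (integrable_exp_gammaMeasure ha hr (w := (t : ℂ)) (by simpa using ht)).norm
    refine this.congr (Filter.Eventually.of_forall fun x => ?_)
    simp [Complex.norm_exp]
  have h1 : AnalyticOnNhd ℂ (complexMGF id (gammaMeasure a r)) {z | z.re < r} :=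
    fun z hz => analyticAt_complexMGF (hsub hz)
  have h2 : AnalyticOnNhd ℂ (fun z : ℂ => ((r : ℂ) / (r - z)) ^ (a : ℂ)) {z | z.re < r} := by
    intro z hz
    have hne : (r : ℂ) - z ≠ 0 := by intro h; have := hre z hz; rw [h] at this; simp at this
    refine AnalyticAt.cpow (analyticAt_const.div (analyticAt_const.sub analyticAt_id) hne)
      analyticAt_const (Or.inl ?_)
    rw [div_eq_mul_inv, Complex.re_ofReal_mul]
    exact mul_pos hr (Complex.re_inv_pos (hre z hz))
  -- Both sides are analytic on `re z < r`, and the real case makes them agree on real points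
  -- accumulating at 0.
  refine h1.eqOn_of_preconnected_of_frequently_eq h2 (convex_halfSpace_re_lt r).isPreconnected
    (z₀ := 0) (by simpa using hr) ?_ hw
  have h_real : ∃ᶠ x : ℝ in 𝓝[≠] 0, complexMGF id (gammaMeasure a r) x
      = ((r : ℂ) / (r - x)) ^ (a : ℂ) := by
    refine Filter.Eventually.frequently ?_
    filter_upwards [mem_nhdsWithin_of_mem_nhds (Iio_mem_nhds hr)] with x hx
    exact integral_exp_gammaMeasure_real ha hr hx
  rw [Filter.frequently_iff_seq_forall] at h_real ⊢
  obtain ⟨xs, hx, hx_eq⟩ := h_real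
  refine ⟨fun n => xs n, ?_, hx_eq⟩
  rw [tendsto_nhdsWithin_iff] at hx ⊢
  exact ⟨by simpa [Function.comp_def] using (Complex.continuous_ofReal.tendsto 0).comp hx.1, by
      simpa using hx.2⟩

/-! ### Averaging over the phase and the fluctuation -/

instance isProbabilityMeasure_uniformPhase : IsProbabilityMeasure uniformPhase := by
  refine cond_isProbabilityMeasure_of_finite ?_ ?_
  · simp [Real.pi_pos]
  · rw [Real.volume_Ioo]; exact ENNReal.ofReal_ne_top

lemma uniformPhase_eq_smul :
    uniformPhase = ENNReal.ofReal (2 * Real.pi)⁻¹ • volume.restrict (Set.Ioo 0 (2 * Real.pi)) := by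
  rw [uniformPhase, ProbabilityTheory.cond, Real.volume_Ioo, sub_zero,
    ENNReal.ofReal_inv_of_pos (by positivity)]

lemma integral_uniformPhase {E : Type*} [NormedAddCommGroup E] [NormedSpace ℝ E] (f : ℝ → E) :
    ∫ θ, f θ ∂uniformPhase = (2 * Real.pi)⁻¹ • ∫ θ in (0 : ℝ)..2 * Real.pi, f θ := by
  rw [uniformPhase_eq_smul, integral_smul_measure, ENNReal.toReal_ofReal (by positivity),
    intervalIntegral.integral_of_le (by positivity), integral_Ioc_eq_integral_Ioo]

/-- Exponential moments of the product of a Gamma variable and a bounded function of an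
independent uniform phase. -/
lemma integrable_exp_uniformPhase_prod_gammaMeasure {m : ℝ} (hm : 0 < m) {c : ℝ → ℝ}
    (hc : Measurable c) {C : ℝ} (hc0 : ∀ θ, 0 ≤ c θ) (hcC : ∀ θ, c θ ≤ C) {w : ℂ}
    (hw : C * w.re < m) :
    Integrable (fun p : ℝ × ℝ => Complex.exp (p.2 * c p.1 * w))
      (uniformPhase.prod (gammaMeasure m m)) := by
  have : IsProbabilityMeasure (gammaMeasure m m) := isProbabilityMeasure_gammaMeasure hm hm
  -- The exponent `max 0 (C * w.re)` dominates `c θ * w.re` for either sign of `w.re`, and remains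
  -- below `m`.
  have h := (integrable_exp_gammaMeasure hm hm (w := ((max 0 (C * w.re) : ℝ) : ℂ))
    (by simpa using ⟨hm, hw⟩)).norm.comp_snd uniformPhase
  refine h.mono' ?_ ?_
  · refine Measurable.aestronglyMeasurable ?_
    fun_prop
  · have hz : ∀ᵐ p : ℝ × ℝ ∂(uniformPhase.prod (gammaMeasure m m)), 0 ≤ p.2 :=
      Measure.quasiMeasurePreserving_snd.ae (ae_nonneg_gammaMeasure m m)
    filter_upwards [hz] with p hp
    rw [Complex.norm_exp, Complex.norm_exp, Real.exp_le_exp]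
    have e1 : (p.2 * c p.1 * w : ℂ).re = p.2 * (c p.1 * w.re) := by
      rw [mul_assoc, Complex.re_ofReal_mul, Complex.re_ofReal_mul]
    have e2 : (((max 0 (C * w.re) : ℝ) : ℂ) * p.2).re = p.2 * max 0 (C * w.re) := by
      rw [Complex.re_ofReal_mul, Complex.ofReal_re, mul_comm]
    rw [e1, e2]
    refine mul_le_mul_of_nonneg_left ?_ hp
    rcases le_or_gt w.re 0 with h | h
    · exact (mul_nonpos_of_nonneg_of_nonpos (hc0 _) h).trans (le_max_left _ _)
    · exact (mul_le_mul_of_nonneg_right (hcC _) h.le).trans (le_max_right _ _)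

/-- By Fubini, the inner integral at fixed phase is the Gamma moment generating function at `c θ *
w`. -/
lemma integral_exp_uniformPhase_prod_gammaMeasure {m : ℝ} (hm : 0 < m) {c : ℝ → ℝ}
    (hc : Measurable c) {C : ℝ} (hc0 : ∀ θ, 0 ≤ c θ) (hcC : ∀ θ, c θ ≤ C) {w : ℂ}
    (hw : C * w.re < m) :
    ∫ p : ℝ × ℝ, Complex.exp (p.2 * c p.1 * w) ∂(uniformPhase.prod (gammaMeasure m m))
      = (2 * Real.pi)⁻¹ * ∫ θ in (0 : ℝ)..2 * Real.pi, (1 - c θ * w / m) ^ (-m : ℂ) := by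
  have : IsProbabilityMeasure (gammaMeasure m m) := isProbabilityMeasure_gammaMeasure hm hm
  rw [integral_prod _ (integrable_exp_uniformPhase_prod_gammaMeasure hm hc hc0 hcC hw),
    integral_uniformPhase, Complex.real_smul, Complex.ofReal_inv]
  push_cast
  congr 1
  refine intervalIntegral.integral_congr fun θ _ => ?_
  have hre : (c θ * w : ℂ).re < m := by
    rw [Complex.re_ofReal_mul]
    rcases le_or_gt w.re 0 with h | h
    · exact (mul_nonpos_of_nonneg_of_nonpos (hc0 _) h).trans_lt hm
    · exact (mul_le_mul_of_nonneg_right (hcC _) h.le).trans_lt hw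
  have h1 : ∀ z : ℝ, Complex.exp (z * c θ * w) = Complex.exp (c θ * w * z) := by
    intro z; congr 1; ring
  simp only [h1]
  rw [integral_exp_gammaMeasure hm hm hre]
  have hm0 : (m : ℂ) ≠ 0 := by exact_mod_cast hm.ne'
  have e : (m : ℂ) / (m - c θ * w) = (1 - c θ * w / m)⁻¹ := by
    rw [← div_self hm0, ← sub_div, inv_div]
  have hpos : 0 < (1 - c θ * w / m : ℂ).re := by
    rw [Complex.sub_re, Complex.one_re, Complex.div_ofReal_re, sub_pos, div_lt_one hm]
    exact hre
  rw [e, Complex.inv_cpow_of_re_pos hpos, Complex.cpow_neg]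

/-- The conditional mean of the noncentrality given the phase difference. -/
noncomputable def noncentralityFactor (μ K Δ θ : ℝ) : ℝ := μ * K * (1 + Δ * Real.cos θ)

lemma measurable_noncentralityFactor (μ K Δ : ℝ) : Measurable (noncentralityFactor μ K Δ) := by
  unfold noncentralityFactor; fun_prop

lemma noncentralityFactor_nonneg {μ K Δ : ℝ} (hμ : 0 < μ) (hK : 0 < K) (h0 : 0 ≤ Δ) (h1 : Δ ≤ 1)
    (θ : ℝ) : 0 ≤ noncentralityFactor μ K Δ θ := by
  have := Real.neg_one_le_cos θ
  refine mul_nonneg (by positivity) ?_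
  nlinarith

lemma noncentralityFactor_le {μ K Δ : ℝ} (hμ : 0 < μ) (hK : 0 < K) (h0 : 0 ≤ Δ) (θ : ℝ) :
    noncentralityFactor μ K Δ θ ≤ μ * K * (1 + Δ) := by
  have := Real.cos_le_one θ
  refine mul_le_mul_of_nonneg_left ?_ (by positivity)
  nlinarith

lemma re_lt_of_mem_halfPlane {m μ K Δ g : ℝ} (hm : 0 < m) (hμ : 0 < μ) (hK : 0 < K) (h0 : 0 ≤ Δ)
    (hg : 0 < g) {s : ℂ} (hs : (m + μ * K * (1 + Δ)) * g * s.re < m * μ * (1 + K)) :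
    g * s.re < μ * (1 + K) := by
  rcases le_or_gt s.re 0 with h | h
  · have : 0 < μ * (1 + K) := by positivity
    nlinarith
  · have h2 : 0 ≤ μ * K * (1 + Δ) * (g * s.re) := by positivity
    have h3 : m * (g * s.re) < m * (μ * (1 + K)) := by nlinarith
    exact lt_of_mul_lt_mul_left h3 hm.le

/-- Write `g s/D = -1 + μ(1+K)/D`. Since `re (1/D) ≤ 1/re D`, the real part is largest at the real
point `re s`, where the claim is the hypothesis cleared of denominators. -/
lemma re_exponent_lt {m μ K Δ g : ℝ} (hm : 0 < m) (hμ : 0 < μ) (hK : 0 < K) (h0 : 0 ≤ Δ)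
    (hg : 0 < g) {s : ℂ} (hs : (m + μ * K * (1 + Δ)) * g * s.re < m * μ * (1 + K)) :
    μ * K * (1 + Δ) * (g * s / (μ * (1 + K) - g * s) : ℂ).re < m := by
  have hlt := re_lt_of_mem_halfPlane hm hμ hK h0 hg hs
  set D : ℂ := μ * (1 + K) - g * s with hD
  have hDre : D.re = μ * (1 + K) - g * s.re := by simp [hD]
  have hpos : 0 < D.re := by rw [hDre]; linarith
  have hD0 : D ≠ 0 := by intro h; rw [h] at hpos; simp at hpos
  have hle : (g * s / D : ℂ).re ≤ -1 + μ * (1 + K) / D.re := by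
    have e : (g * s / D : ℂ) = -1 + ((μ * (1 + K) : ℝ) : ℂ) * D⁻¹ := by
      field_simp; rw [hD]; push_cast; ring
    rw [e, Complex.add_re, Complex.re_ofReal_mul, div_eq_mul_inv]
    have : D⁻¹.re ≤ D.re⁻¹ := by
      refine (Complex.re_le_norm _).trans ?_
      rw [norm_inv]
      exact inv_anti₀ hpos (Complex.re_le_norm _)
    have := mul_le_mul_of_nonneg_left this (by positivity : 0 ≤ μ * (1 + K))
    simpa using this
  refine (mul_le_mul_of_nonneg_left hle (by positivity)).trans_lt ?_
  have : -1 + μ * (1 + K) / D.re = g * s.re / D.re := by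
    field_simp; rw [hDre]; ring
  rw [this, ← mul_div_assoc, div_lt_iff₀ hpos, hDre]
  nlinarith

lemma integrable_exp_noncentrality {m μ K Δ g : ℝ} (hm : 0 < m) (hμ : 0 < μ) (hK : 0 < K)
    (h0 : 0 ≤ Δ) (h1 : Δ ≤ 1) (hg : 0 < g) {s : ℂ}
    (hs : (m + μ * K * (1 + Δ)) * g * s.re < m * μ * (1 + K)) :
    Integrable (fun p : ℝ × ℝ => Complex.exp (p.2 * noncentralityFactor μ K Δ p.1
      * (g * s / (μ * (1 + K) - g * s)))) (uniformPhase.prod (gammaMeasure m m)) :=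
  integrable_exp_uniformPhase_prod_gammaMeasure hm (measurable_noncentralityFactor μ K Δ)
    (noncentralityFactor_nonneg hμ hK h0 h1) (noncentralityFactor_le hμ hK h0)
    (re_exponent_lt hm hμ hK h0 hg hs)

/-- The common target of the two models: once conditioned on phase and fluctuation, each yields this
prefactor and this integral. -/
lemma mftrClosedForm_eq_integral {m μ K Δ g : ℝ} (hm : 0 < m) (hμ : 0 < μ) (hK : 0 < K)
    (h0 : 0 ≤ Δ) (h1 : Δ ≤ 1) (hg : 0 < g) {s : ℂ}
    (hs : (m + μ * K * (1 + Δ)) * g * s.re < m * μ * (1 + K)) :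
    mftrClosedForm μ m K Δ g s
      = ((μ * (1 + K)) / (μ * (1 + K) - g * s)) ^ (μ : ℂ) *
        ∫ p : ℝ × ℝ, Complex.exp (p.2 * noncentralityFactor μ K Δ p.1
          * (g * s / (μ * (1 + K) - g * s))) ∂(uniformPhase.prod (gammaMeasure m m)) := by
  rw [mftrClosedForm_eq hm hμ hK h0 h1 hg hs, integral_exp_uniformPhase_prod_gammaMeasure hm
    (measurable_noncentralityFactor μ K Δ) (noncentralityFactor_nonneg hμ hK h0 h1)
    (noncentralityFactor_le hμ hK h0) (re_exponent_lt hm hμ hK h0 hg hs)]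
  rfl

/-! ### Noncentral Gamma laws and the model with real `μ` -/

lemma withDensity_noncentralGammaPDF (μ r l : ℝ) :
    volume.withDensity (noncentralGammaPDF μ r l) = Measure.sum fun k : ℕ =>
      ENNReal.ofReal (Real.exp (-l) * l ^ k / (k.factorial : ℝ)) • gammaMeasure (μ + k) r := by
  have h : noncentralGammaPDF μ r l = ∑' k : ℕ, fun x =>
      ENNReal.ofReal (Real.exp (-l) * l ^ k / (k.factorial : ℝ)) * gammaPDF (μ + k) r x := by
    ext x
    rw [ENNReal.tsum_apply]
    rfl
  rw [h, withDensity_tsum fun k => (measurable_gammaPDF _ _).const_mul _]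
  congr 1
  ext1 k
  exact withDensity_smul _ (measurable_gammaPDF _ _)

/-- Absolute integrability at `s` thereby becomes the same exponential integral at the real point
`re s`. -/
lemma norm_exp_mul_ofReal (s : ℂ) (x : ℝ) :
    ((‖Complex.exp (s * x)‖ : ℝ) : ℂ) = Complex.exp ((s.re : ℂ) * x) := by
  rw [Complex.norm_exp, Complex.ofReal_exp]
  simp

/-- The exponential series at `l r/(r-s)`, combined with `e^{-l}`: the exponents add up to `l
s/(r-s)`. -/
lemma hasSum_poisson_mul_pow {r l μ : ℝ} {s : ℂ} (hr : 0 < r) (hs : s.re < r) :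
    HasSum (fun k : ℕ => ((Real.exp (-l) * l ^ k / (k.factorial : ℝ) : ℝ) : ℂ)
      * ((r : ℂ) / (r - s)) ^ ((μ + k : ℝ) : ℂ))
      (((r : ℂ) / (r - s)) ^ (μ : ℂ) * Complex.exp (l * (s / (r - s)))) := by
  have hre : 0 < ((r : ℂ) - s).re := by simpa using hs
  have hne : (r : ℂ) - s ≠ 0 := by intro h; rw [h] at hre; simp at hre
  have hr0 : (r : ℂ) ≠ 0 := by exact_mod_cast hr.ne'
  have h := (NormedSpace.expSeries_div_hasSum_exp (l * ((r : ℂ) / (r - s)))).mul_left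
    (Complex.exp (-l) * ((r : ℂ) / (r - s)) ^ (μ : ℂ))
  rw [← Complex.exp_eq_exp_ℂ, mul_right_comm, ← Complex.exp_add,
    show -(l : ℂ) + l * ((r : ℂ) / (r - s)) = l * (s / (r - s)) by field_simp; ring] at h
  rw [mul_comm (((r : ℂ) / (r - s)) ^ (μ : ℂ))]
  refine Eq.subst (motive := fun f => HasSum f _) (funext fun k => ?_) h
  rw [Complex.ofReal_add, Complex.cpow_add _ _ (div_ne_zero hr0 hne), Complex.ofReal_natCast,
    Complex.cpow_natCast]
  push_cast
  rw [mul_pow]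
  ring

lemma integrable_exp_noncentralGamma {μ r l : ℝ} (hμ : 0 < μ) (hr : 0 < r) (hl : 0 ≤ l) {s : ℂ}
    (hs : s.re < r) :
    Integrable (fun x : ℝ => Complex.exp (s * x))
      (volume.withDensity (noncentralGammaPDF μ r l)) := by
  rw [withDensity_noncentralGammaPDF]
  refine integrable_sum_measure (fun k => ?_) ?_
  · exact (integrable_exp_gammaMeasure (by positivity) hr hs).smul_measure ENNReal.ofReal_ne_top
  · rw [← Complex.summable_ofReal]
    refine (hasSum_poisson_mul_pow (l := l) (μ := μ) (s := (s.re : ℂ)) hr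
      (by simpa using hs)).summable.congr fun k => ?_
    rw [integral_smul_measure, ENNReal.toReal_ofReal (by positivity), smul_eq_mul,
      Complex.ofReal_mul, ← integral_complex_ofReal]
    simp only [norm_exp_mul_ofReal]
    rw [integral_exp_gammaMeasure (by positivity) hr (by simpa using hs)]

/-- The moment generating function of the noncentral Gamma distribution. -/
lemma integral_exp_noncentralGamma {μ r l : ℝ} (hμ : 0 < μ) (hr : 0 < r) (hl : 0 ≤ l) {s : ℂ}
    (hs : s.re < r) :
    ∫ x : ℝ, Complex.exp (s * x) ∂(volume.withDensity (noncentralGammaPDF μ r l))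
      = ((r : ℂ) / (r - s)) ^ (μ : ℂ) * Complex.exp (l * (s / (r - s))) := by
  have h := integrable_exp_noncentralGamma hμ hr hl hs
  rw [withDensity_noncentralGammaPDF] at h ⊢
  refine (hasSum_integral_measure h).unique ?_
  refine Eq.subst (motive := fun f => HasSum f _) (funext fun k => ?_)
    (hasSum_poisson_mul_pow (l := l) (μ := μ) hr hs)
  rw [integral_smul_measure, ENNReal.toReal_ofReal (by positivity), Complex.real_smul,
    integral_exp_gammaMeasure (by positivity) hr hs]

lemma measurable_noncentralGammaPDF (μ K Δ r : ℝ) :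
    Measurable (Function.uncurry fun (p : ℝ × ℝ) (x : ℝ) =>
      noncentralGammaPDF μ r (p.2 * noncentralityFactor μ K Δ p.1) x) := by
  refine Measurable.tsum fun k => ?_
  have h1 := measurable_noncentralityFactor μ K Δ
  have h2 := measurable_gammaPDF (μ + k) r
  refine Measurable.mul ?_ (h2.comp measurable_snd)
  fun_prop

/-- The conditional distribution of the signal-to-noise ratio given the phase difference and the
fluctuation. -/
noncomputable def mftrKernel (μ K Δ r : ℝ) : Kernel (ℝ × ℝ) ℝ :=
  Kernel.withDensity (Kernel.const _ volume) fun p x =>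
    noncentralGammaPDF μ r (p.2 * noncentralityFactor μ K Δ p.1) x

lemma mftrKernel_apply (μ K Δ r : ℝ) (p : ℝ × ℝ) :
    mftrKernel μ K Δ r p = volume.withDensity
      (noncentralGammaPDF μ r (p.2 * noncentralityFactor μ K Δ p.1)) := by
  rw [mftrKernel, Kernel.withDensity_apply _ (measurable_noncentralGammaPDF μ K Δ r),
    Kernel.const_apply]

/-- Tonelli moves the integral over `x` inside. In this form the law can be integrated conditionally
on phase and fluctuation. -/
lemma mftrMeasure_eq_comp {m : ℝ} (hm : 0 < m) (μ K Δ g : ℝ) :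
    mftrMeasure μ m K Δ g
      = (uniformPhase.prod (gammaMeasure m m)).bind (mftrKernel μ K Δ (μ * (1 + K) / g)) := by
  have : IsProbabilityMeasure (gammaMeasure m m) := isProbabilityMeasure_gammaMeasure hm hm
  have hmeas := measurable_noncentralGammaPDF μ K Δ (μ * (1 + K) / g)
  ext S hS
  rw [Measure.bind_apply hS (Kernel.aemeasurable _), mftrMeasure, withDensity_apply _ hS]
  simp only [mftrKernel_apply, withDensity_apply _ hS]
  rw [lintegral_lintegral_swap (hmeas.aemeasurable)]
  refine lintegral_congr fun x => ?_
  exact (lintegral_prod _ (hmeas.comp (measurable_id.prodMk measurable_const)).aemeasurable).symm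

/-- The moment generating function in the model with a real number of clusters. -/
lemma hasMFTRMGF_of_hasLaw {Ω : Type*} [MeasurableSpace Ω] {P : Measure Ω} {m μ K Δ g : ℝ}
    {γ : Ω → ℝ} (hm : 0 < m) (hμ : 0 < μ) (hK : 0 < K) (h0 : 0 ≤ Δ) (h1 : Δ ≤ 1) (hg : 0 < g)
    (hγ : HasLaw γ (mftrMeasure μ m K Δ g) P) : HasMFTRMGF P γ μ m K Δ g := by
  intro s hs
  have : IsProbabilityMeasure (gammaMeasure m m) := isProbabilityMeasure_gammaMeasure hm hm
  set r := μ * (1 + K) / g with hr_def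
  have hr : 0 < r := by positivity
  have hsr : s.re < r := by
    rw [hr_def, lt_div_iff₀ hg, mul_comm]
    exact re_lt_of_mem_halfPlane hm hμ hK h0 hg hs
  have hg0 : (g : ℂ) ≠ 0 := by exact_mod_cast hg.ne'
  have hgr : (μ * (1 + K) : ℂ) = g * r := by
    rw [hr_def]; push_cast; field_simp
  have hw : ∀ z : ℂ, g * z / (μ * (1 + K) - g * z) = z / (r - z) := fun z => by
    rw [hgr, ← mul_sub, mul_div_mul_left _ _ hg0]
  have hrr : ∀ z : ℂ, (μ * (1 + K) : ℂ) / (μ * (1 + K) - g * z) = r / (r - z) := fun z => by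
    rw [hgr, ← mul_sub, mul_div_mul_left _ _ hg0]
  have hnn : ∀ᵐ p : ℝ × ℝ ∂(uniformPhase.prod (gammaMeasure m m)),
      0 ≤ p.2 * noncentralityFactor μ K Δ p.1 := by
    filter_upwards [Measure.quasiMeasurePreserving_snd.ae (ae_nonneg_gammaMeasure m m)] with p hp
    exact mul_nonneg hp (noncentralityFactor_nonneg hμ hK h0 h1 _)
  have hsre : (m + μ * K * (1 + Δ)) * g * (s.re : ℂ).re < m * μ * (1 + K) := by simpa using hs
  have hmeasexp : Measurable fun x : ℝ => Complex.exp (s * x) := by fun_prop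
  have hint : Integrable (fun x : ℝ => Complex.exp (s * x)) (mftrMeasure μ m K Δ g) := by
    rw [mftrMeasure_eq_comp hm, Measure.integrable_comp_iff hmeasexp.aestronglyMeasurable]
    constructor
    · filter_upwards [hnn] with p hp
      rw [mftrKernel_apply]
      exact integrable_exp_noncentralGamma hμ hr hp hsr
    -- The conditional integral of the norm is the conditional moment generating function at `re s`;
    -- its integrability over the parameters is the exponential moment at that real point.
    · have hR := ((integrable_exp_noncentrality hm hμ hK h0 h1 hg hsre).const_mul
        (((r : ℂ) / (r - s.re)) ^ (μ : ℂ))).re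
      refine hR.congr ?_
      filter_upwards [hnn] with p hp
      rw [mftrKernel_apply, ← Complex.ofReal_re (∫ y : ℝ, _ ∂_), ← integral_complex_ofReal]
      simp only [norm_exp_mul_ofReal]
      rw [integral_exp_noncentralGamma hμ hr hp (by simpa using hsr), hw]
      simp
  have hlaw : ∫ ω, Complex.exp (s * γ ω) ∂P = ∫ x : ℝ, Complex.exp (s * x) ∂(mftrMeasure μ m K Δ g)
      :=
    hγ.integral_comp (f := fun x : ℝ => Complex.exp (s * x)) hmeasexp.aestronglyMeasurable
  refine ⟨?_, ?_⟩
  · have := hint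
    rw [← hγ.map_eq, integrable_map_measure hmeasexp.aestronglyMeasurable hγ.aemeasurable] at this
    exact this
  · rw [complexMGF, hlaw, mftrClosedForm_eq_integral hm hμ hK h0 h1 hg hs]
    rw [mftrMeasure_eq_comp hm, Measure.comp_eq_comp_const_apply] at hint ⊢
    rw [Kernel.integral_comp hint, Kernel.const_apply, ← integral_const_mul]
    refine integral_congr_ae ?_
    filter_upwards [hnn] with p hp
    rw [mftrKernel_apply, integral_exp_noncentralGamma hμ hr hp hsr, hw, hrr]
    simp

/-! ### Squares of shifted Gaussians -/

lemma gaussianPDFReal_smul_exp_sq {v : NNReal} (hv : v ≠ 0) (t : ℂ) (a x : ℝ) :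
    gaussianPDFReal 0 v x • Complex.exp (t * ((a + x) ^ 2 : ℝ))
      = ((√(2 * Real.pi * v))⁻¹ : ℝ) *
        Complex.exp ((t - (2 * v : ℂ)⁻¹) * x ^ 2 + 2 * t * a * x + t * a ^ 2) := by
  have hv0 : (v : ℂ) ≠ 0 := by exact_mod_cast hv
  rw [gaussianPDFReal, Complex.real_smul, Complex.ofReal_mul, mul_assoc, Complex.ofReal_exp,
    ← Complex.exp_add]
  congr 2
  push_cast
  field_simp
  ring

lemma re_quadraticCoeff_neg {v : NNReal} (hv : v ≠ 0) {t : ℂ} (ht : 2 * v * t.re < 1) :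
    (t - (2 * v : ℂ)⁻¹).re < 0 := by
  have hv' : (0 : ℝ) < v := by exact_mod_cast pos_iff_ne_zero.mpr hv
  have e : (t - (2 * v : ℂ)⁻¹) = t - (((2 * v : ℝ)⁻¹ : ℝ) : ℂ) := by push_cast; ring
  rw [e, Complex.sub_re, Complex.ofReal_re, sub_neg, ← one_div, lt_div_iff₀ (by positivity)]
  linarith

lemma integrable_exp_sq_gaussianReal {v : NNReal} (hv : v ≠ 0) {t : ℂ} (ht : 2 * v * t.re < 1)
    (a : ℝ) :
    Integrable (fun x : ℝ => Complex.exp (t * ((a + x) ^ 2 : ℝ))) (gaussianReal 0 v) := by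
  rw [gaussianReal_of_var_ne_zero _ hv, integrable_withDensity_iff_integrable_smul'
    (measurable_gaussianPDF 0 v) (by simp [gaussianPDF])]
  simp only [toReal_gaussianPDF, gaussianPDFReal_smul_exp_sq hv]
  exact (integrable_cexp_quadratic' (re_quadraticCoeff_neg hv ht) _ _).const_mul _

/-- A complex Gaussian integral. Completing the square leaves `t a² + 2 v t² a²/(1 - 2 v t) = a²
t/(1 - 2 v t)` in the exponent. -/
lemma integral_exp_sq_gaussianReal {v : NNReal} (hv : v ≠ 0) {t : ℂ} (ht : 2 * v * t.re < 1)
    (a : ℝ) :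
    ∫ x : ℝ, Complex.exp (t * ((a + x) ^ 2 : ℝ)) ∂(gaussianReal 0 v)
      = (1 - 2 * v * t) ^ (-(1 / 2) : ℂ) * Complex.exp ((a ^ 2 : ℝ) * (t / (1 - 2 * v * t))) := by
  have hv' : (0 : ℝ) < v := by exact_mod_cast pos_iff_ne_zero.mpr hv
  have hv0 : (v : ℂ) ≠ 0 := by exact_mod_cast hv
  have hre : 0 < (1 - 2 * v * t : ℂ).re := by
    have : (1 - 2 * v * t : ℂ).re = 1 - 2 * v * t.re := by simp
    rw [this]; linarith
  have hne : (1 - 2 * v * t : ℂ) ≠ 0 := by intro h; rw [h] at hre; simp at hre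
  rw [integral_gaussianReal_eq_integral_smul hv]
  simp only [gaussianPDFReal_smul_exp_sq hv]
  rw [integral_const_mul, integral_cexp_quadratic (re_quadraticCoeff_neg hv ht), ← mul_assoc]
  have hb : t - (2 * v : ℂ)⁻¹ = -((1 - 2 * v * t) / (2 * v)) := by field_simp; ring
  have e1 : (Real.pi / -(t - (2 * v : ℂ)⁻¹) : ℂ) = ((2 * Real.pi * v : ℝ) : ℂ) / (1 - 2 * v * t) :=
      by
    rw [hb]; push_cast; field_simp
  rw [e1, Complex.div_cpow_of_re_pos _ hre, Complex.cpow_neg]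
  · congr 1
    · rw [Real.sqrt_eq_rpow, Complex.ofReal_inv, Complex.ofReal_cpow (by positivity)]
      have : (((2 * Real.pi * v : ℝ) : ℂ) ^ (1 / 2 : ℂ)) ≠ 0 := by
        rw [Complex.cpow_ne_zero_iff]
        left
        exact_mod_cast (by positivity : (2 * Real.pi * v : ℝ) ≠ 0)
      push_cast at this ⊢
      field_simp
    · congr 1
      rw [hb]
      generalize hD : (1 - 2 * v * t : ℂ) = D at hne
      have ht' : 2 * v * t = 1 - D := by rw [← hD]; ring
      push_cast
      field_simp
      linear_combination 4 * t * a ^ 2 * ht'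
  · rw [Complex.ofReal_re]; positivity

lemma integral_add_sq_gaussianReal (v : NNReal) (a : ℝ) :
    ∫ x : ℝ, (a + x) ^ 2 ∂(gaussianReal 0 v) = a ^ 2 + v := by
  have h2 : Integrable (fun x : ℝ => x ^ 2) (gaussianReal 0 v) :=
    (memLp_id_gaussianReal (μ := 0) (v := v) 2).integrable_sq
  have h1 : Integrable (fun x : ℝ => x) (gaussianReal 0 v) :=
    (memLp_id_gaussianReal (μ := 0) (v := v) 1).integrable le_rfl
  have hvar : ∫ x : ℝ, x ^ 2 ∂(gaussianReal 0 v) = v := by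
    have := variance_id_gaussianReal (μ := 0) (v := v)
    rw [variance_eq_integral (by fun_prop)] at this
    simpa using this
  have e : ∀ x : ℝ, (a + x) ^ 2 = a ^ 2 + 2 * a * x + x ^ 2 := fun x => by ring
  simp only [e]
  have h3 : Integrable (fun x : ℝ => a ^ 2 + 2 * a * x) (gaussianReal 0 v) :=
    (integrable_const _).add (h1.const_mul _)
  rw [integral_add h3 h2, integral_add (integrable_const _) (h1.const_mul _), integral_const_mul,
      hvar]
  simp

lemma integrable_add_sq_gaussianReal (v : NNReal) (a : ℝ) :
    Integrable (fun x : ℝ => (a + x) ^ 2) (gaussianReal 0 v) :=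
  ((memLp_const a).add (memLp_id_gaussianReal (μ := 0) (v := v) 2)).integrable_sq

/-! ### Gaussian vectors with an independent random shift -/

section ShiftedGaussian

variable {Ω ι : Type*} [MeasurableSpace Ω] [Fintype ι] {P : Measure Ω} [IsProbabilityMeasure P]
  {a x : Ω → ι → ℝ} {v : NNReal}

lemma integrable_exp_sum_sq_pi (hv : v ≠ 0) {t : ℂ} (ht : 2 * v * t.re < 1) (a : ι → ℝ) :
    Integrable (fun x : ι → ℝ => Complex.exp (t * (∑ j, (a j + x j) ^ 2 : ℝ)))
      (Measure.pi fun _ => gaussianReal 0 v) := by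
  have := Integrable.fintype_prod (μ := fun _ : ι => gaussianReal 0 v)
    (fun j => integrable_exp_sq_gaussianReal hv ht (a j))
  refine this.congr (Filter.Eventually.of_forall fun x => ?_)
  simp only
  rw [← Complex.exp_sum, Complex.ofReal_sum, Finset.mul_sum]

lemma integral_exp_sum_sq_pi (hv : v ≠ 0) {t : ℂ} (ht : 2 * v * t.re < 1) (a : ι → ℝ) :
    ∫ x : ι → ℝ, Complex.exp (t * (∑ j, (a j + x j) ^ 2 : ℝ))
        ∂(Measure.pi fun _ => gaussianReal 0 v)
      = ((1 - 2 * v * t) ^ (-(1 / 2) : ℂ)) ^ Fintype.card ι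
        * Complex.exp ((∑ j, a j ^ 2 : ℝ) * (t / (1 - 2 * v * t))) := by
  have := integral_fintype_prod_eq_prod (μ := fun _ : ι => gaussianReal 0 v)
    (fun j (y : ℝ) => Complex.exp (t * ((a j + y) ^ 2 : ℝ)))
  simp only [integral_exp_sq_gaussianReal hv ht, Finset.prod_mul_distrib, Finset.prod_const,
    Finset.card_univ, ← Complex.exp_sum, ← Finset.sum_mul, ← Finset.mul_sum,
    ← Complex.ofReal_sum] at this
  exact this

lemma integral_sum_sq_pi (a : ι → ℝ) :
    ∫ x : ι → ℝ, ∑ j, (a j + x j) ^ 2 ∂(Measure.pi fun _ => gaussianReal 0 v)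
      = ∑ j, a j ^ 2 + Fintype.card ι * v := by
  rw [integral_finsetSum _ fun j _ => integrable_comp_eval (i := j)
    (μ := fun _ : ι => gaussianReal 0 v) (f := fun y : ℝ => (a j + y) ^ 2)
    (integrable_add_sq_gaussianReal v (a j))]
  have : ∀ j, ∫ x : ι → ℝ, (a j + x j) ^ 2 ∂(Measure.pi fun _ => gaussianReal 0 v)
      = a j ^ 2 + v := fun j => by
    rw [integral_comp_eval (i := j) (μ := fun _ : ι => gaussianReal 0 v)
      (f := fun y : ℝ => (a j + y) ^ 2) (by fun_prop), integral_add_sq_gaussianReal]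
  simp [this, Finset.sum_add_distrib]

lemma hasLaw_shift_noise (ha : AEMeasurable a P)
    (hx : HasLaw x (Measure.pi fun _ => gaussianReal 0 v) P) (hax : IndepFun a x P) :
    HasLaw (fun ω => (a ω, x ω)) ((P.map a).prod (Measure.pi fun _ => gaussianReal 0 v)) P :=
  IndepFun.hasLaw_prod ⟨ha, rfl⟩ hx hax

/-- Integrating the norm over the noise at a fixed shift gives the explicit formula at `re t`; hence
the moment required of the shift involves only `re t`. -/
lemma integrable_exp_sum_sq_prod (ha : AEMeasurable a P) (hv : v ≠ 0) {t : ℂ} (ht : 2 * v * t.re <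
    1)
    (hint : Integrable (fun ω => Complex.exp ((∑ j, a ω j ^ 2 : ℝ)
      * ((t.re : ℂ) / (1 - 2 * v * t.re)))) P) :
    Integrable (fun p : (ι → ℝ) × (ι → ℝ) => Complex.exp (t * (∑ j, (p.1 j + p.2 j) ^ 2 : ℝ)))
      ((P.map a).prod (Measure.pi fun _ => gaussianReal 0 v)) := by
  have := Measure.isProbabilityMeasure_map ha
  rw [integrable_prod_iff (by fun_prop)]
  refine ⟨Filter.Eventually.of_forall fun b => integrable_exp_sum_sq_pi hv ht b, ?_⟩
  have h1 : Integrable (fun b : ι → ℝ => ((1 - 2 * v * (t.re : ℂ)) ^ (-(1 / 2) : ℂ)) ^ Fintype.card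
      ι
        * Complex.exp ((∑ j, b j ^ 2 : ℝ) * ((t.re : ℂ) / (1 - 2 * v * t.re)))) (P.map a) := by
    refine Integrable.const_mul ?_ _
    rw [integrable_map_measure (Measurable.aestronglyMeasurable (by fun_prop)) ha]
    exact hint
  refine h1.re.congr (Filter.Eventually.of_forall fun b => ?_)
  simp only
  rw [← integral_exp_sum_sq_pi hv (by simpa using ht)]
  simp only [← norm_exp_mul_ofReal]
  rw [integral_complex_ofReal]
  simp

lemma integrable_exp_sum_sq (ha : AEMeasurable a P)
    (hx : HasLaw x (Measure.pi fun _ => gaussianReal 0 v) P) (hax : IndepFun a x P)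
    (hv : v ≠ 0) {t : ℂ} (ht : 2 * v * t.re < 1)
    (hint : Integrable (fun ω => Complex.exp ((∑ j, a ω j ^ 2 : ℝ)
      * ((t.re : ℂ) / (1 - 2 * v * t.re)))) P) :
    Integrable (fun ω => Complex.exp (t * (∑ j, (a ω j + x ω j) ^ 2 : ℝ))) P := by
  have hl := hasLaw_shift_noise ha hx hax
  have h := integrable_exp_sum_sq_prod ha hv ht hint
  rw [← hl.map_eq, integrable_map_measure (by fun_prop) hl.aemeasurable] at h
  exact h

/-- The moment generating function of the squared norm of a randomly shifted Gaussian vector. -/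
lemma integral_exp_sum_sq (ha : AEMeasurable a P)
    (hx : HasLaw x (Measure.pi fun _ => gaussianReal 0 v) P) (hax : IndepFun a x P)
    (hv : v ≠ 0) {t : ℂ} (ht : 2 * v * t.re < 1)
    (hint : Integrable (fun ω => Complex.exp ((∑ j, a ω j ^ 2 : ℝ)
      * ((t.re : ℂ) / (1 - 2 * v * t.re)))) P) :
    ∫ ω, Complex.exp (t * (∑ j, (a ω j + x ω j) ^ 2 : ℝ)) ∂P
      = ((1 - 2 * v * t) ^ (-(1 / 2) : ℂ)) ^ Fintype.card ι
        * ∫ ω, Complex.exp ((∑ j, a ω j ^ 2 : ℝ) * (t / (1 - 2 * v * t))) ∂P := by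
  have := Measure.isProbabilityMeasure_map ha
  have hl := hasLaw_shift_noise ha hx hax
  have h := integrable_exp_sum_sq_prod ha hv ht hint
  have e := hl.integral_comp (f := fun p : (ι → ℝ) × (ι → ℝ) =>
    Complex.exp (t * (∑ j, (p.1 j + p.2 j) ^ 2 : ℝ))) (by fun_prop)
  simp only [Function.comp_def] at e
  rw [e, integral_prod _ h]
  simp only [integral_exp_sum_sq_pi hv ht]
  rw [integral_const_mul, integral_map ha (Measurable.aestronglyMeasurable (by fun_prop))]

lemma integral_sum_sq (ha : AEMeasurable a P)
    (hx : HasLaw x (Measure.pi fun _ => gaussianReal 0 v) P) (hax : IndepFun a x P)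
    (hint : Integrable (fun ω => ∑ j, (a ω j + x ω j) ^ 2) P) :
    ∫ ω, ∑ j, (a ω j + x ω j) ^ 2 ∂P = ∫ ω, (∑ j, a ω j ^ 2 + Fintype.card ι * v) ∂P := by
  have := Measure.isProbabilityMeasure_map ha
  have hl := hasLaw_shift_noise ha hx hax
  have e := hl.integral_comp (f := fun p : (ι → ℝ) × (ι → ℝ) => ∑ j, (p.1 j + p.2 j) ^ 2)
    (by fun_prop)
  have h : Integrable (fun p : (ι → ℝ) × (ι → ℝ) => ∑ j, (p.1 j + p.2 j) ^ 2)
      ((P.map a).prod (Measure.pi fun _ => gaussianReal 0 v)) := by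
    rw [← hl.map_eq, integrable_map_measure (by fun_prop) hl.aemeasurable]
    exact hint
  simp only [Function.comp_def] at e
  rw [e, integral_prod _ h]
  simp only [integral_sum_sq_pi]
  rw [integral_map ha (Measurable.aestronglyMeasurable (by fun_prop))]

end ShiftedGaussian

/-! ### The specular shift and the phase difference -/

/-- The complex amplitudes of the specular components of the clusters, given the fluctuation `z`
and the phases. -/
noncomputable def specularAmplitude {n : ℕ} (V₁ V₂ : ℝ) (U : Fin n → ℝ) (z f₁ f₂ : ℝ)
    (f : Fin n → ℝ) : Fin (n + 1) → ℂ :=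
  Fin.cons (((√z : ℝ) : ℂ) * (V₁ * Complex.exp (f₁ * Complex.I) + V₂ * Complex.exp (f₂ *
      Complex.I)))
    fun i => ((√z : ℝ) : ℂ) * (U i * Complex.exp (f i * Complex.I))

/-- The in-phase and quadrature parts of the specular components. -/
noncomputable def specularShift {n : ℕ} (V₁ V₂ : ℝ) (U : Fin n → ℝ) (z f₁ f₂ : ℝ)
    (f : Fin n → ℝ) : Fin (n + 1) ⊕ Fin (n + 1) → ℝ :=
  Sum.elim (fun i => (specularAmplitude V₁ V₂ U z f₁ f₂ f i).re)
    (fun i => (specularAmplitude V₁ V₂ U z f₁ f₂ f i).im)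

/-- The diffuse sources. -/
def MFTRSource.diffuse {n : ℕ} : Fin (n + 1) ⊕ Fin (n + 1) → MFTRSource n :=
  Sum.elim .inPhase .quadrature

lemma MFTRSource.diffuse_injective {n : ℕ} : Function.Injective (MFTRSource.diffuse (n := n)) := by
  rintro (i | i) (j | j) h <;> simp_all [MFTRSource.diffuse]

lemma measurable_specularAmplitude {α : Type*} [MeasurableSpace α] {n : ℕ} (V₁ V₂ : ℝ)
    (U : Fin n → ℝ) {z f₁ f₂ : α → ℝ} {f : α → Fin n → ℝ} (hz : Measurable z) (h₁ : Measurable f₁)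
    (h₂ : Measurable f₂) (hf : ∀ i, Measurable fun y => f y i) (i : Fin (n + 1)) :
    Measurable fun y => specularAmplitude V₁ V₂ U (z y) (f₁ y) (f₂ y) (f y) i := by
  have := hz.sqrt
  refine Fin.cases ?_ (fun i => ?_) i
  · simp only [specularAmplitude, Fin.cons_zero]
    fun_prop
  · simp only [specularAmplitude, Fin.cons_succ]
    have := hf i
    fun_prop

lemma measurable_specularShift {α : Type*} [MeasurableSpace α] {n : ℕ} (V₁ V₂ : ℝ)
    (U : Fin n → ℝ) {z f₁ f₂ : α → ℝ} {f : α → Fin n → ℝ} (hz : Measurable z) (h₁ : Measurable f₁)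
    (h₂ : Measurable f₂) (hf : ∀ i, Measurable fun y => f y i) :
    Measurable fun y => specularShift V₁ V₂ U (z y) (f₁ y) (f₂ y) (f y) := by
  refine measurable_pi_iff.mpr ?_
  rintro (i | i)
  · exact Complex.measurable_re.comp (measurable_specularAmplitude V₁ V₂ U hz h₁ h₂ hf i)
  · exact Complex.measurable_im.comp (measurable_specularAmplitude V₁ V₂ U hz h₁ h₂ hf i)

/-- Identifies `ℂ^(n+1)` with `ℝ^(2(n+1))`, so that the diffuse part becomes a vector of independent
real Gaussians of equal variance. -/
lemma sum_specularShift_add_sq {n : ℕ} (V₁ V₂ : ℝ) (U : Fin n → ℝ) (z f₁ f₂ : ℝ) (f : Fin n → ℝ)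
    (x : Fin (n + 1) ⊕ Fin (n + 1) → ℝ) :
    ∑ j, (specularShift V₁ V₂ U z f₁ f₂ f j + x j) ^ 2
      = ∑ i, ‖specularAmplitude V₁ V₂ U z f₁ f₂ f i + (x (.inl i) + x (.inr i) * Complex.I)‖ ^ 2 :=
          by
  rw [Fintype.sum_sum_type, ← Finset.sum_add_distrib]
  refine Finset.sum_congr rfl fun i _ => ?_
  rw [Complex.sq_norm, Complex.normSq_apply]
  simp [specularShift]
  ring

lemma mftrPower_eq_sum {Ω : Type*} {n : ℕ} (V₁ V₂ : ℝ) (U : Fin n → ℝ) (ξ : MFTRSource n → Ω → ℝ)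
    (ω : Ω) : mftrPower V₁ V₂ U ξ ω = ∑ j, (specularShift V₁ V₂ U (ξ .fluctuation ω)
      (ξ .phase₁ ω) (ξ .phase₂ ω) (fun i => ξ (.clusterPhase i) ω) j + ξ (.diffuse j) ω) ^ 2 := by
  rw [sum_specularShift_add_sq V₁ V₂ U _ _ _ _ (fun j => ξ (.diffuse j) ω), Fin.sum_univ_succ]
  rfl

lemma normSq_add_phases (V₁ V₂ f₁ f₂ : ℝ) :
    ‖(V₁ * Complex.exp (f₁ * Complex.I) + V₂ * Complex.exp (f₂ * Complex.I) : ℂ)‖ ^ 2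
      = V₁ ^ 2 + V₂ ^ 2 + 2 * V₁ * V₂ * Real.cos (f₁ - f₂) := by
  rw [Complex.sq_norm, Complex.normSq_apply, Real.cos_sub]
  simp only [Complex.exp_ofReal_mul_I_re, Complex.exp_ofReal_mul_I_im, Complex.add_re,
      Complex.add_im,
    Complex.re_ofReal_mul, Complex.im_ofReal_mul]
  linear_combination V₁ ^ 2 * Real.sin_sq_add_cos_sq f₁ + V₂ ^ 2 * Real.sin_sq_add_cos_sq f₂

/-- The additional cluster phases vanish on taking moduli. Nonnegativity of `z` is needed for `(√z)²
= z`. -/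
lemma sum_specularShift_sq {n : ℕ} (V₁ V₂ : ℝ) (U : Fin n → ℝ) {z : ℝ} (hz : 0 ≤ z) (f₁ f₂ : ℝ)
    (f : Fin n → ℝ) :
    ∑ j, specularShift V₁ V₂ U z f₁ f₂ f j ^ 2
      = z * (specularPower V₁ V₂ U + 2 * V₁ * V₂ * Real.cos (f₁ - f₂)) := by
  have h := sum_specularShift_add_sq V₁ V₂ U z f₁ f₂ f (fun _ => 0)
  simp only [add_zero, Complex.ofReal_zero, zero_mul] at h
  rw [h, Fin.sum_univ_succ]
  simp only [specularAmplitude, Fin.cons_zero, Fin.cons_succ, norm_mul, mul_pow,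
    normSq_add_phases, Complex.norm_exp_ofReal_mul_I, Complex.norm_real, Real.norm_eq_abs, sq_abs,
    Real.sq_sqrt hz, mul_one, ← Finset.mul_sum]
  rw [specularPower]
  ring

/-- The integral of a `2π`-periodic function over a full period is invariant under translation. -/
lemma uniformPhase_real_cos_sub (y : ℝ) {S : Set ℝ} (hS : MeasurableSet S) :
    uniformPhase.real {x | Real.cos (x - y) ∈ S} = uniformPhase.real {x | Real.cos x ∈ S} := by
  have key : ∀ y : ℝ, uniformPhase.real {x | Real.cos (x - y) ∈ S}
      = (2 * Real.pi)⁻¹ • ∫ x in (0 : ℝ)..2 * Real.pi, S.indicator (1 : ℝ → ℝ) (Real.cos (x - y))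
          := by
    intro y
    have hm : MeasurableSet {x | Real.cos (x - y) ∈ S} :=
      (by fun_prop : Measurable fun x => Real.cos (x - y)) hS
    rw [← integral_indicator_one hm, integral_uniformPhase]
    rfl
  have h0 := key 0
  simp only [sub_zero] at h0
  rw [key y, h0]
  congr 1
  rw [intervalIntegral.integral_comp_sub_right (fun x => S.indicator (1 : ℝ → ℝ) (Real.cos x)) y]
  have hp : Function.Periodic (fun x => S.indicator (1 : ℝ → ℝ) (Real.cos x)) (2 * Real.pi) :=
    fun x => by simp [Real.cos_periodic x]
  have := hp.intervalIntegral_add_eq (0 - y) 0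
  rw [zero_add] at this
  rw [← this]
  congr 1
  ring

/-- Fix the second phase and use translation invariance. Working with the cosine avoids reducing the
difference modulo `2π`. -/
lemma map_cos_sub_uniformPhase :
    (uniformPhase.prod uniformPhase).map (fun p => Real.cos (p.1 - p.2))
      = uniformPhase.map Real.cos := by
  have hm : Measurable fun p : ℝ × ℝ => Real.cos (p.1 - p.2) := by fun_prop
  ext S hS
  rw [Measure.map_apply hm hS, Measure.map_apply Real.measurable_cos hS,
    Measure.prod_apply_symm (hm hS)]
  have : ∀ y, uniformPhase ((fun x => (x, y)) ⁻¹' ((fun p : ℝ × ℝ => Real.cos (p.1 - p.2)) ⁻¹' S))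
      = uniformPhase (Real.cos ⁻¹' S) := by
    intro y
    rw [← measureReal_eq_measureReal_iff]
    exact uniformPhase_real_cos_sub y hS
  simp [this]

/-! ### Laws and independence of the sources -/

section Sources

variable {Ω : Type*} [MeasurableSpace Ω] {P : Measure Ω} {n : ℕ}
  {m σ : ℝ} {ξ : MFTRSource n → Ω → ℝ}

lemma IsMFTRSources.aemeasurable (h : IsMFTRSources P m σ ξ) (j : MFTRSource n) :
    AEMeasurable (ξ j) P := (h.hasLaw j).aemeasurable

lemma IsMFTRSources.hasLaw_diffuse (h : IsMFTRSources P m σ ξ) :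
    HasLaw (fun ω j => ξ (.diffuse j) ω)
      (Measure.pi fun _ : Fin (n + 1) ⊕ Fin (n + 1) => gaussianReal 0 (Real.toNNReal (σ ^ 2))) P :=
          by
  refine iIndepFun.hasLaw_pi (X := fun j => ξ (.diffuse j)) (fun j => ?_)
    (h.indep.precomp MFTRSource.diffuse_injective)
  rcases j with i | i
  · exact h.hasLaw (.inPhase i)
  · exact h.hasLaw (.quadrature i)

-- The shift depends only on the fluctuation and the phases, a set of sources disjoint from the
-- diffuse ones; independence of disjoint blocks passes to measurable functions of them.
open Classical in
lemma IsMFTRSources.indepFun_specularShift_diffuse (h : IsMFTRSources P m σ ξ) (V₁ V₂ : ℝ)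
    (U : Fin n → ℝ) :
    IndepFun (fun ω => specularShift V₁ V₂ U (ξ .fluctuation ω) (ξ .phase₁ ω) (ξ .phase₂ ω)
      (fun i => ξ (.clusterPhase i) ω)) (fun ω j => ξ (.diffuse j) ω) P := by
  let S : Finset (MFTRSource n) :=
    {.fluctuation, .phase₁, .phase₂} ∪ Finset.univ.image .clusterPhase
  let T : Finset (MFTRSource n) := Finset.univ.image .diffuse
  have hST : Disjoint S T := by
    rw [Finset.disjoint_left]
    intro j hS hT
    simp only [S, T, Finset.mem_union, Finset.mem_insert, Finset.mem_singleton, Finset.mem_image,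
      Finset.mem_univ, true_and] at hS hT
    obtain ⟨i | i, rfl⟩ := hT <;> simp [MFTRSource.diffuse] at hS
  have hS : ∀ i : Fin n, MFTRSource.clusterPhase i ∈ S := fun i => by simp [S]
  have hT : ∀ j, MFTRSource.diffuse j ∈ T := fun j => by simp [T]
  have key := (h.indep.indepFun_finset₀ S T hST h.aemeasurable).comp
    (φ := fun y : S → ℝ => specularShift V₁ V₂ U (y ⟨.fluctuation, by simp [S]⟩)
      (y ⟨.phase₁, by simp [S]⟩) (y ⟨.phase₂, by simp [S]⟩) (fun i => y ⟨.clusterPhase i, hS i⟩))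
    (ψ := fun (y : T → ℝ) j => y ⟨.diffuse j, hT j⟩)
    (measurable_specularShift V₁ V₂ U (by fun_prop) (by fun_prop) (by fun_prop)
      (fun i => by fun_prop)) (by fun_prop)
  exact key

lemma IsMFTRSources.aemeasurable_specularShift (h : IsMFTRSources P m σ ξ) (V₁ V₂ : ℝ) (U : Fin n →
    ℝ) :
    AEMeasurable (fun ω => specularShift V₁ V₂ U (ξ .fluctuation ω) (ξ .phase₁ ω) (ξ .phase₂ ω)
      (fun i => ξ (.clusterPhase i) ω)) P := by
  have h1 : Measurable fun y : (ℝ × ℝ) × ℝ × (Fin n → ℝ) =>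
      specularShift V₁ V₂ U y.1.1 y.1.2 y.2.1 y.2.2 :=
    measurable_specularShift V₁ V₂ U (by fun_prop) (by fun_prop) (by fun_prop)
      (fun i => by fun_prop)
  exact h1.comp_aemeasurable (((h.aemeasurable _).prodMk (h.aemeasurable _)).prodMk
    ((h.aemeasurable _).prodMk (aemeasurable_pi_lambda _ fun i => h.aemeasurable _)))

/-- The joint distribution of the cosine of the phase difference and the fluctuation. -/
lemma IsMFTRSources.hasLaw_cos_fluctuation (hm : 0 < m) (h : IsMFTRSources P m σ ξ) :
    HasLaw (fun ω => (Real.cos (ξ .phase₁ ω - ξ .phase₂ ω), ξ .fluctuation ω))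
      ((uniformPhase.prod (gammaMeasure m m)).map (Prod.map Real.cos id)) P := by
  have : IsProbabilityMeasure (gammaMeasure m m) := isProbabilityMeasure_gammaMeasure hm hm
  have := h.indep.isProbabilityMeasure
  rw [← Measure.map_prod_map _ _ Real.measurable_cos measurable_id, Measure.map_id,
    ← map_cos_sub_uniformPhase]
  have hm2 : Measurable fun p : ℝ × ℝ => Real.cos (p.1 - p.2) := by fun_prop
  have h12 : HasLaw (fun ω => (ξ .phase₁ ω, ξ .phase₂ ω)) (uniformPhase.prod uniformPhase) P :=
    IndepFun.hasLaw_prod (h.hasLaw .phase₁) (h.hasLaw .phase₂) (h.indep.indepFun (by simp))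
  refine IndepFun.hasLaw_prod ?_ (h.hasLaw .fluctuation) ?_
  · exact HasLaw.fun_comp (X := fun ω => (ξ .phase₁ ω, ξ .phase₂ ω))
      (Y := fun p : ℝ × ℝ => Real.cos (p.1 - p.2)) ⟨hm2.aemeasurable, rfl⟩ h12
  · exact (h.indep.indepFun_prodMk₀ h.aemeasurable .phase₁ .phase₂ .fluctuation (by simp)
      (by simp)).comp hm2 measurable_id

lemma IsMFTRSources.integral_cos_fluctuation {E : Type*} [NormedAddCommGroup E] [NormedSpace ℝ E]
    (hm : 0 < m) (h : IsMFTRSources P m σ ξ) {F : ℝ × ℝ → E} (hF : StronglyMeasurable F) :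
    ∫ ω, F (Real.cos (ξ .phase₁ ω - ξ .phase₂ ω), ξ .fluctuation ω) ∂P
      = ∫ p, F (Real.cos p.1, p.2) ∂(uniformPhase.prod (gammaMeasure m m)) := by
  have hl := h.hasLaw_cos_fluctuation hm
  have e := hl.integral_comp (f := F) hF.aestronglyMeasurable
  rw [integral_map (by fun_prop) hF.aestronglyMeasurable] at e
  exact e

lemma IsMFTRSources.integrable_cos_fluctuation {E : Type*} [NormedAddCommGroup E]
    (hm : 0 < m) (h : IsMFTRSources P m σ ξ) {F : ℝ × ℝ → E} (hF : StronglyMeasurable F)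
    (hint : Integrable (fun p => F (Real.cos p.1, p.2)) (uniformPhase.prod (gammaMeasure m m))) :
    Integrable (fun ω => F (Real.cos (ξ .phase₁ ω - ξ .phase₂ ω), ξ .fluctuation ω)) P := by
  have hl := h.hasLaw_cos_fluctuation hm
  have e : Integrable F ((uniformPhase.prod (gammaMeasure m m)).map (Prod.map Real.cos id)) := by
    rw [integrable_map_measure hF.aestronglyMeasurable (by fun_prop)]
    exact hint
  rw [← hl.map_eq, integrable_map_measure hF.aestronglyMeasurable hl.aemeasurable] at e
  exact e

lemma IsMFTRSources.ae_fluctuation_nonneg (h : IsMFTRSources P m σ ξ) :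
    ∀ᵐ ω ∂P, 0 ≤ ξ .fluctuation ω :=
  ((h.hasLaw .fluctuation).ae_iff (p := fun x => 0 ≤ x)
    (measurableSet_setOfPred.mp measurableSet_Ici)).mpr
    (ae_nonneg_gammaMeasure m m)

end Sources

/-! ### The mean and the physical model -/

/-- Multiplying the density of shape `a` by `x` gives `a/r` times the density of shape `a + 1`,
which has total mass 1. -/
lemma integral_id_gammaMeasure {a r : ℝ} (ha : 0 < a) (hr : 0 < r) :
    ∫ x, x ∂(gammaMeasure a r) = a / r := by
  rw [gammaMeasure, integral_withDensity_eq_integral_toReal_smul (measurable_gammaPDF a r)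
    (by simp [gammaPDF])]
  have key : ∀ x : ℝ, (gammaPDF a r x).toReal • x = a / r * (gammaPDF (a + 1) r x).toReal := by
    intro x
    rcases lt_or_ge x 0 with hx | hx
    · simp [gammaPDF_of_neg hx]
    · have hG := Real.Gamma_pos_of_pos ha
      have hG1 := Real.Gamma_pos_of_pos (by linarith : 0 < a + 1)
      rw [gammaPDF_of_nonneg hx, gammaPDF_of_nonneg hx, ENNReal.toReal_ofReal (by positivity),
        ENNReal.toReal_ofReal (by positivity), Real.Gamma_add_one ha.ne', Real.rpow_add_one hr.ne',
        smul_eq_mul, add_sub_cancel_right]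
      have hxa : x ^ a = x ^ (a - 1) * x := by
        rcases hx.eq_or_lt with rfl | hx'
        · simp [Real.zero_rpow ha.ne']
        · rw [← Real.rpow_add_one hx'.ne', sub_add_cancel]
      rw [hxa]
      field_simp
  simp only [key]
  rw [integral_const_mul, integral_toReal (measurable_gammaPDF _ _).aemeasurable
    (Filter.Eventually.of_forall fun x => ENNReal.ofReal_lt_top),
    lintegral_gammaPDF_eq_one (by linarith) hr]
  simp

lemma integral_cos_uniformPhase : ∫ θ, Real.cos θ ∂uniformPhase = 0 := by
  rw [integral_uniformPhase]
  simp

section Physical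

variable {Ω : Type*} [MeasurableSpace Ω] {P : Measure Ω} {n : ℕ} {m σ V₁ V₂ E : ℝ} {U : Fin n → ℝ}
  {ξ : MFTRSource n → Ω → ℝ}

/-- The mean of the signal-to-noise ratio, in terms of the powers of the components. -/
noncomputable def mftrMean {n : ℕ} (V₁ V₂ : ℝ) (U : Fin n → ℝ) (σ E : ℝ) : ℝ :=
  E * (specularPower V₁ V₂ U + 2 * σ ^ 2 * ((n : ℝ) + 1))

lemma mftrΔ_nonneg (h₁ : 0 ≤ V₁) (h₂ : 0 ≤ V₂) (hS : 0 < specularPower V₁ V₂ U) :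
    0 ≤ mftrΔ V₁ V₂ U := by
  unfold mftrΔ; positivity

lemma mftrΔ_le_one (hS : 0 < specularPower V₁ V₂ U) : mftrΔ V₁ V₂ U ≤ 1 := by
  rw [mftrΔ, div_le_one hS, specularPower]
  have : 0 ≤ ∑ i, U i ^ 2 := Finset.sum_nonneg fun i _ => sq_nonneg _
  nlinarith [sq_nonneg (V₁ - V₂)]

lemma mftrK_pos (hS : 0 < specularPower V₁ V₂ U) (hσ : 0 < σ) : 0 < mftrK V₁ V₂ U σ := by
  unfold mftrK; positivity

lemma noncentralityFactor_eq (hS : 0 < specularPower V₁ V₂ U) (hσ : 0 < σ) (θ : ℝ) :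
    noncentralityFactor ((n : ℝ) + 1) (mftrK V₁ V₂ U σ) (mftrΔ V₁ V₂ U) θ
      = (specularPower V₁ V₂ U + 2 * V₁ * V₂ * Real.cos θ) / (2 * σ ^ 2) := by
  have hS' := hS.ne'
  have hn : (n : ℝ) + 1 ≠ 0 := by positivity
  unfold noncentralityFactor mftrK mftrΔ
  field_simp

/-- In other words, the mean is `μ(1+K)` times `2σ²E`, the mean diffuse contribution of one cluster.
This dictionary makes `μ(1+K)` cancel from the quotients in the closed form. -/
lemma mul_mftrMean_eq (hσ : 0 < σ) (s : ℂ) :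
    (mftrMean V₁ V₂ U σ E : ℂ) * s
      = (((n : ℝ) + 1 : ℝ) : ℂ) * (1 + mftrK V₁ V₂ U σ) * (2 * (σ ^ 2 : ℝ) * (E * s)) := by
  have hn : (n : ℂ) + 1 ≠ 0 := by exact_mod_cast n.succ_ne_zero
  have hσ0 : (σ : ℂ) ≠ 0 := by exact_mod_cast hσ.ne'
  unfold mftrMean mftrK
  push_cast
  field_simp
  ring

lemma one_add_mftrK_ne_zero (hS : 0 < specularPower V₁ V₂ U) (hσ : 0 < σ) :
    (((n : ℝ) + 1 : ℝ) : ℂ) * (1 + mftrK V₁ V₂ U σ) ≠ 0 := by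
  have := mftrK_pos hS hσ
  have h : ((n : ℝ) + 1) * (1 + mftrK V₁ V₂ U σ) ≠ 0 := by positivity
  exact_mod_cast h

lemma exponent_eq (hS : 0 < specularPower V₁ V₂ U) (hσ : 0 < σ) (s : ℂ) :
    (mftrMean V₁ V₂ U σ E : ℂ) * s / ((((n : ℝ) + 1 : ℝ) : ℂ) * (1 + mftrK V₁ V₂ U σ)
      - mftrMean V₁ V₂ U σ E * s)
      = 2 * (σ ^ 2 : ℝ) * (E * s / (1 - 2 * (σ ^ 2 : ℝ) * (E * s))) := by
  rw [mul_mftrMean_eq hσ, ← mul_one_sub, mul_div_mul_left _ _ (one_add_mftrK_ne_zero hS hσ),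
    mul_div_assoc]

lemma base_eq (hS : 0 < specularPower V₁ V₂ U) (hσ : 0 < σ) (s : ℂ) :
    (((n : ℝ) + 1 : ℝ) : ℂ) * (1 + mftrK V₁ V₂ U σ)
      / ((((n : ℝ) + 1 : ℝ) : ℂ) * (1 + mftrK V₁ V₂ U σ) - mftrMean V₁ V₂ U σ E * s)
      = (1 - 2 * (σ ^ 2 : ℝ) * (E * s))⁻¹ := by
  rw [mul_mftrMean_eq hσ, ← mul_one_sub, div_mul_cancel_left₀ (one_add_mftrK_ne_zero hS hσ)]

lemma mftrMean_pos (hS : 0 < specularPower V₁ V₂ U) (hσ : 0 < σ) (hE : 0 < E) :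
    0 < mftrMean V₁ V₂ U σ E := by
  unfold mftrMean; positivity

lemma stronglyMeasurable_exp_noncentrality (a b : ℝ) (w : ℂ) :
    StronglyMeasurable fun p : ℝ × ℝ => Complex.exp ((p.2 * (a + b * p.1) : ℝ) * w) :=
  Measurable.stronglyMeasurable (by fun_prop)

lemma IsMFTRSources.exp_sum_specularShift_sq_ae_eq (h : IsMFTRSources P m σ ξ) (w : ℂ) :
    (fun ω => Complex.exp ((∑ j, specularShift V₁ V₂ U (ξ .fluctuation ω) (ξ .phase₁ ω)
        (ξ .phase₂ ω) (fun i => ξ (.clusterPhase i) ω) j ^ 2 : ℝ) * w))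
      =ᵐ[P] fun ω => Complex.exp ((ξ .fluctuation ω * (specularPower V₁ V₂ U
        + 2 * V₁ * V₂ * Real.cos (ξ .phase₁ ω - ξ .phase₂ ω)) : ℝ) * w) := by
  filter_upwards [h.ae_fluctuation_nonneg] with ω hω
  rw [sum_specularShift_sq V₁ V₂ U hω]

lemma exp_noncentrality_eq (hS : 0 < specularPower V₁ V₂ U) (hσ : 0 < σ) (s : ℂ) (p : ℝ × ℝ) :
    Complex.exp (p.2 * noncentralityFactor ((n : ℝ) + 1) (mftrK V₁ V₂ U σ) (mftrΔ V₁ V₂ U) p.1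
      * (mftrMean V₁ V₂ U σ E * s / ((((n : ℝ) + 1 : ℝ) : ℂ) * (1 + mftrK V₁ V₂ U σ)
        - mftrMean V₁ V₂ U σ E * s)))
      = Complex.exp ((p.2 * (specularPower V₁ V₂ U + 2 * V₁ * V₂ * Real.cos p.1) : ℝ)
        * (E * s / (1 - 2 * (σ ^ 2 : ℝ) * (E * s)))) := by
  have hσ0 : (σ : ℂ) ≠ 0 := by exact_mod_cast hσ.ne'
  rw [exponent_eq hS hσ, noncentralityFactor_eq hS hσ, ← mul_assoc, mul_assoc (p.2 : ℂ)]
  congr 2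
  push_cast
  field_simp

lemma IsMFTRSources.integrable_exp_sum_specularShift_sq (hm : 0 < m) (h₁ : 0 ≤ V₁) (h₂ : 0 ≤ V₂)
    (hS : 0 < specularPower V₁ V₂ U) (hσ : 0 < σ) (hE : 0 < E) (h : IsMFTRSources P m σ ξ) {s : ℂ}
    (hs : (m + ((n : ℝ) + 1) * mftrK V₁ V₂ U σ * (1 + mftrΔ V₁ V₂ U)) * mftrMean V₁ V₂ U σ E * s.re
      < m * ((n : ℝ) + 1) * (1 + mftrK V₁ V₂ U σ)) :
    Integrable (fun ω => Complex.exp ((∑ j, specularShift V₁ V₂ U (ξ .fluctuation ω) (ξ .phase₁ ω)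
      (ξ .phase₂ ω) (fun i => ξ (.clusterPhase i) ω) j ^ 2 : ℝ)
        * (E * s / (1 - 2 * (σ ^ 2 : ℝ) * (E * s))))) P := by
  refine Integrable.congr ?_ (h.exp_sum_specularShift_sq_ae_eq _).symm
  refine h.integrable_cos_fluctuation hm (stronglyMeasurable_exp_noncentrality _ (2 * V₁ * V₂) _) ?_
  refine (integrable_exp_noncentrality hm (by positivity) (mftrK_pos hS hσ) (mftrΔ_nonneg h₁ h₂ hS)
    (mftrΔ_le_one hS) (mftrMean_pos hS hσ hE) hs).congr (Filter.Eventually.of_forall fun p => ?_)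
  exact exp_noncentrality_eq hS hσ s p

lemma IsMFTRSources.integral_exp_sum_specularShift_sq (hm : 0 < m)
    (hS : 0 < specularPower V₁ V₂ U) (hσ : 0 < σ) (h : IsMFTRSources P m σ ξ) (s : ℂ) :
    ∫ ω, Complex.exp ((∑ j, specularShift V₁ V₂ U (ξ .fluctuation ω) (ξ .phase₁ ω)
      (ξ .phase₂ ω) (fun i => ξ (.clusterPhase i) ω) j ^ 2 : ℝ)
        * (E * s / (1 - 2 * (σ ^ 2 : ℝ) * (E * s)))) ∂P
      = ∫ p : ℝ × ℝ, Complex.exp (p.2 * noncentralityFactor ((n : ℝ) + 1) (mftrK V₁ V₂ U σ)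
        (mftrΔ V₁ V₂ U) p.1 * (mftrMean V₁ V₂ U σ E * s / ((((n : ℝ) + 1 : ℝ) : ℂ)
          * (1 + mftrK V₁ V₂ U σ) - mftrMean V₁ V₂ U σ E * s)))
        ∂(uniformPhase.prod (gammaMeasure m m)) := by
  simp only [exp_noncentrality_eq hS hσ]
  rw [integral_congr_ae (h.exp_sum_specularShift_sq_ae_eq _)]
  exact h.integral_cos_fluctuation hm
    (stronglyMeasurable_exp_noncentrality (specularPower V₁ V₂ U) (2 * V₁ * V₂) _)

/-- The moment generating function in the physical model, for the mean computed from the powers. -/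
lemma IsMFTRSources.hasMFTRMGF (hm : 0 < m) (h₁ : 0 ≤ V₁) (h₂ : 0 ≤ V₂)
    (hS : 0 < specularPower V₁ V₂ U) (hσ : 0 < σ) (hE : 0 < E) (h : IsMFTRSources P m σ ξ) :
    HasMFTRMGF P (fun ω => E * mftrPower V₁ V₂ U ξ ω) ((n : ℝ) + 1) m (mftrK V₁ V₂ U σ)
      (mftrΔ V₁ V₂ U) (mftrMean V₁ V₂ U σ E) := by
  intro s hs
  have := h.indep.isProbabilityMeasure
  have hK := mftrK_pos hS hσ
  have hΔ0 := mftrΔ_nonneg h₁ h₂ hS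
  have hG := mftrMean_pos hS hσ hE
  have hn : 0 < (n : ℝ) + 1 := by positivity
  set v : NNReal := Real.toNNReal (σ ^ 2) with hv_def
  have hv : (v : ℝ) = σ ^ 2 := Real.coe_toNNReal _ (sq_nonneg _)
  have hv0 : v ≠ 0 := by
    have : (v : ℝ) ≠ 0 := by rw [hv]; positivity
    exact_mod_cast this
  have ht : 2 * v * (E * s : ℂ).re < 1 := by
    have hlt := re_lt_of_mem_halfPlane hm hn hK hΔ0 hG hs
    have e := congrArg Complex.re (mul_mftrMean_eq (V₁ := V₁) (V₂ := V₂) (U := U) (E := E) hσ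
      (s.re : ℂ))
    have e' : mftrMean V₁ V₂ U σ E * s.re
        = ((n : ℝ) + 1) * (1 + mftrK V₁ V₂ U σ) * (2 * σ ^ 2 * (E * s.re)) := by
      exact_mod_cast e
    rw [e'] at hlt
    have hpos : 0 < ((n : ℝ) + 1) * (1 + mftrK V₁ V₂ U σ) := by positivity
    rw [Complex.re_ofReal_mul, hv]
    exact lt_of_mul_lt_mul_left (by linarith) hpos.le
  have hsre : (m + ((n : ℝ) + 1) * mftrK V₁ V₂ U σ * (1 + mftrΔ V₁ V₂ U)) * mftrMean V₁ V₂ U σ E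
      * (s.re : ℂ).re < m * ((n : ℝ) + 1) * (1 + mftrK V₁ V₂ U σ) := by simpa using hs
  have hint := h.integrable_exp_sum_specularShift_sq hm h₁ h₂ hS hσ hE hsre
  rw [← hv, ← Complex.ofReal_mul E s.re, ← Complex.re_ofReal_mul E s] at hint
  have hexp : ∀ ω, Complex.exp (s * ((E * mftrPower V₁ V₂ U ξ ω : ℝ) : ℂ))
      = Complex.exp (E * s * (mftrPower V₁ V₂ U ξ ω : ℂ)) := fun ω => by
    push_cast; congr 1; ring
  have ha := h.aemeasurable_specularShift V₁ V₂ U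
  have hax := h.indepFun_specularShift_diffuse V₁ V₂ U
  constructor
  · simp only [hexp]
    simp only [mftrPower_eq_sum]
    exact integrable_exp_sum_sq ha h.hasLaw_diffuse hax hv0 ht hint
  · rw [complexMGF]
    simp only [hexp]
    simp only [mftrPower_eq_sum]
    rw [integral_exp_sum_sq ha h.hasLaw_diffuse hax hv0 ht hint,
      mftrClosedForm_eq_integral hm hn hK hΔ0 (mftrΔ_le_one hS) hG hs, base_eq hS hσ,
      ← h.integral_exp_sum_specularShift_sq hm hS hσ, ← hv_def, hv]
    congr 1
    have hre : 0 < (1 - 2 * (σ ^ 2 : ℝ) * (E * s) : ℂ).re := by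
      have e : (1 - 2 * (σ ^ 2 : ℝ) * (E * s) : ℂ) = 1 - ((2 * σ ^ 2 : ℝ) : ℂ) * (E * s) := by
        push_cast; ring
      rw [e, Complex.sub_re, Complex.one_re, Complex.re_ofReal_mul, ← hv]
      linarith
    have hne : (1 - 2 * (σ ^ 2 : ℝ) * (E * s) : ℂ) ≠ 0 := by
      intro h0; rw [h0] at hre; simp at hre
    -- The `2(n+1)` factors `(1 - 2σ²Es)^(-1/2)` pair up into an integer power, matching the power
    -- `μ = n + 1` without any choice of branch.
    rw [show (((n : ℝ) + 1 : ℝ) : ℂ) = ((n + 1 : ℕ) : ℂ) by push_cast; rfl, Complex.cpow_natCast,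
      Fintype.card_sum, Fintype.card_fin, pow_add, ← mul_pow, ← Complex.cpow_add _ _ hne]
    norm_num
    rw [Complex.cpow_neg_one, inv_pow]

/-- Exponential moments exist at all real `t < d/c`, hence in a neighbourhood of 0, which makes the
variable integrable. -/
lemma IsMFTRSources.integrable_snr (hm : 0 < m) (h₁ : 0 ≤ V₁) (h₂ : 0 ≤ V₂)
    (hS : 0 < specularPower V₁ V₂ U) (hσ : 0 < σ) (hE : 0 < E) (h : IsMFTRSources P m σ ξ) :
    Integrable (fun ω => E * mftrPower V₁ V₂ U ξ ω) P := by
  have hK := mftrK_pos hS hσ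
  have hΔ0 := mftrΔ_nonneg h₁ h₂ hS
  have hG := mftrMean_pos hS hσ hE
  set c := (m + ((n : ℝ) + 1) * mftrK V₁ V₂ U σ * (1 + mftrΔ V₁ V₂ U)) * mftrMean V₁ V₂ U σ E
  set d := m * ((n : ℝ) + 1) * (1 + mftrK V₁ V₂ U σ)
  have hc : 0 < c := by positivity
  have hd : 0 < d := by positivity
  refine integrable_of_mem_interior_integrableExpSet ?_
  refine interior_maximal (s := integrableExpSet _ P) (t := Set.Iio (d / c)) (fun t ht => ?_)
    isOpen_Iio (by simpa using div_pos hd hc)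
  have ht' : c * t < d := by rw [mul_comm, ← lt_div_iff₀ hc]; exact ht
  refine (h.hasMFTRMGF hm h₁ h₂ hS hσ hE (t : ℂ) (by simpa using ht')).1.norm.congr
    (Filter.Eventually.of_forall fun ω => ?_)
  simp [Complex.norm_exp]

/-- Given the shift, the mean power is its squared length plus `2(n+1)σ²`; averaging uses that the
fluctuation has mean 1 and the independent cosine has mean 0. -/
lemma IsMFTRSources.integral_snr (hm : 0 < m) (h₁ : 0 ≤ V₁) (h₂ : 0 ≤ V₂)
    (hS : 0 < specularPower V₁ V₂ U) (hσ : 0 < σ) (hE : 0 < E) (h : IsMFTRSources P m σ ξ) :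
    ∫ ω, E * mftrPower V₁ V₂ U ξ ω ∂P = mftrMean V₁ V₂ U σ E := by
  have := h.indep.isProbabilityMeasure
  have : IsProbabilityMeasure (gammaMeasure m m) := isProbabilityMeasure_gammaMeasure hm hm
  have hint : Integrable (fun ω => mftrPower V₁ V₂ U ξ ω) P :=
    (integrable_const_mul_iff (IsUnit.mk0 E hE.ne') _).mp (h.integrable_snr hm h₁ h₂ hS hσ hE)
  rw [integral_const_mul, mftrMean]
  congr 1
  simp only [mftrPower_eq_sum] at hint ⊢
  rw [integral_sum_sq (h.aemeasurable_specularShift V₁ V₂ U) h.hasLaw_diffuse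
    (h.indepFun_specularShift_diffuse V₁ V₂ U) hint, Real.coe_toNNReal _ (sq_nonneg _)]
  have hae : (fun ω => ∑ j, specularShift V₁ V₂ U (ξ .fluctuation ω) (ξ .phase₁ ω)
      (ξ .phase₂ ω) (fun i => ξ (.clusterPhase i) ω) j ^ 2
        + (Fintype.card (Fin (n + 1) ⊕ Fin (n + 1)) : ℝ) * σ ^ 2)
      =ᵐ[P] fun ω => ξ .fluctuation ω * (specularPower V₁ V₂ U
        + 2 * V₁ * V₂ * Real.cos (ξ .phase₁ ω - ξ .phase₂ ω)) + 2 * σ ^ 2 * ((n : ℝ) + 1) := by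
    filter_upwards [h.ae_fluctuation_nonneg] with ω hω
    rw [sum_specularShift_sq V₁ V₂ U hω]
    simp
    ring
  rw [integral_congr_ae hae]
  have hF : StronglyMeasurable fun p : ℝ × ℝ => p.2 * (specularPower V₁ V₂ U
      + 2 * V₁ * V₂ * p.1) + 2 * σ ^ 2 * ((n : ℝ) + 1) :=
    Measurable.stronglyMeasurable (by fun_prop)
  have hgam : Integrable (fun z : ℝ => z) (gammaMeasure m m) := by
    -- A non-integrable function has Bochner integral 0 by convention, so the nonzero mean already
    -- gives integrability.
    refine Integrable.of_integral_ne_zero ?_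
    rw [integral_id_gammaMeasure hm hm]
    simp [hm.ne']
  have hcos : Integrable Real.cos uniformPhase :=
    Integrable.of_bound Real.measurable_cos.aestronglyMeasurable 1
      (Filter.Eventually.of_forall Real.abs_cos_le_one)
  have hlin : Integrable (fun θ => specularPower V₁ V₂ U + 2 * V₁ * V₂ * Real.cos θ) uniformPhase :=
    (integrable_const _).add (hcos.const_mul _)
  rw [h.integral_cos_fluctuation hm hF, integral_add, integral_const]
  · have e := integral_prod_mul (μ := uniformPhase) (ν := gammaMeasure m m)
      (fun θ => specularPower V₁ V₂ U + 2 * V₁ * V₂ * Real.cos θ) (fun z => z)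
    simp only [mul_comm (Prod.snd _)]
    rw [e, integral_id_gammaMeasure hm hm, integral_add (integrable_const _) (hcos.const_mul _),
      integral_const_mul, integral_cos_uniformPhase, div_self hm.ne']
    simp
  · exact (hlin.mul_prod hgam).congr (Filter.Eventually.of_forall fun p => mul_comm _ _)
  · exact integrable_const _

end Physical

/-- The first part is the physical model with `n + 1` clusters, whose parameters `K`, `Δ` and mean
`E[γ]` are computed from the model; the second part is the model with a real number `μ` of
clusters, parametrized by `K`, `Δ` and the mean `g`. -/
theorem lemma1 {Ω : Type*} [MeasurableSpace Ω] (P : Measure Ω) [IsProbabilityMeasure P]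
    (m : ℝ) (hm : 0 < m) :
    (∀ (n : ℕ) (V₁ V₂ : ℝ) (U : Fin n → ℝ) (σ Es N₀ : ℝ) (ξ : MFTRSource n → Ω → ℝ) (γ : Ω → ℝ),
      0 ≤ V₁ → 0 ≤ V₂ → (∀ i, 0 ≤ U i) → 0 < specularPower V₁ V₂ U →
      0 < σ → 0 < Es → 0 < N₀ →
      IsMFTRSources P m σ ξ →
      (∀ ω, γ ω = Es / N₀ * mftrPower V₁ V₂ U ξ ω) →
      HasMFTRMGF P γ ((n : ℝ) + 1) m (mftrK V₁ V₂ U σ) (mftrΔ V₁ V₂ U) (∫ ω, γ ω ∂P)) ∧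
    (∀ (μ K Δ g : ℝ) (γ : Ω → ℝ),
      0 < μ → 0 < K → 0 ≤ Δ → Δ ≤ 1 → 0 < g →
      HasLaw γ (mftrMeasure μ m K Δ g) P →
      HasMFTRMGF P γ μ m K Δ g) := by
  refine ⟨?_, fun μ K Δ g γ hμ hK h0 h1 hg hγ => hasMFTRMGF_of_hasLaw hm hμ hK h0 h1 hg hγ⟩
  intro n V₁ V₂ U σ Es N₀ ξ γ h₁ h₂ _ hS hσ hEs hN₀ h hγ
  obtain rfl : γ = fun ω => Es / N₀ * mftrPower V₁ V₂ U ξ ω := funext hγ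
  rw [h.integral_snr hm h₁ h₂ hS hσ (div_pos hEs hN₀)]
  exact h.hasMFTRMGF hm h₁ h₂ hS hσ (div_pos hEs hN₀)
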